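/- Let $M$ be a smooth Riemannian manifold (without boundary, with countable topology, not necessarily complete) with volume measure $dM$, let $1<p<\infty$, and let $\Omega\subset M$ be a bounded domain, i.e. a nonempty connected open set of finite diameter for the Riemannian distance. For a function $f$ put $\Delta_p f=\operatorname{div}\big(\|\nabla f\|^{p-2}\nabla f\big)$, where the field $\|\nabla f\|^{p-2}\nabla f$ is taken to be $0$ at the points where $\nabla f=0$. Let $W^{1,p}_0(\Omega)$ be the closure of $C_c^\infty(\Omega)$ in $W^{1,p}(\Omega)$, and let $$\lambda_{1,p}(\Omega)=\inf\left\{\frac{\int_\Omega\|\nabla u\|^p\,dM}{\int_\Omega|u|^p\,dM}\;:\;u\in W^{1,p}_0(\Omega),\ u\neq0\right\}$$ be the first Dirichlet eigenvalue of the $p$-Laplacian on $\Omega$. Suppose that there are constants $a,b>0$ and a smooth function $f:\Omega\to\mathbb R$ with $\|\nabla f\|\le a$ and $\Delta_p f\ge b$ on $\Omega$. The second inequality is understood either pointwise (the field $\|\nabla f\|^{p-2}\nabla f$ being differentiable at every point of $\Omega$), or in the weak sense, i.e. $-\int_\Omega\langle\|\nabla f\|^{p-2}\nabla f,\nabla\varphi\rangle\,dM\ge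 b\int_\Omega\varphi\,dM$ for all $0\le\varphi\in C_c^\infty(\Omega)$; either one suffices. Then $$\lambda_{1,p}(\Omega)\ \ge\ \frac{b^p}{p^p\,a^{p(p-1)}}.$$ In particular, every $\lambda\in\mathbb R$ for which the problem $\Delta_p u+\lambda|u|^{p-2}u=0$ in $\Omega$, $u=0$ on $\partial\Omega$, has a nonzero weak solution $u\in W^{1,p}_0(\Omega)$ satisfies $\lambda\ge b^p/(p^p a^{p(p-1)})$. -/

import Mathlib

open MeasureTheory Set Filter Topology Bundle Manifold
open scoped ENNReal ContDiff

noncomputable section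

namespace RiemannianPLaplacian

/-- A second countable manifold is covered by a sequence of chart domains. -/
theorem exists_chart_cover (n : ℕ) (M : Type*) [EMetricSpace M]
    [ChartedSpace (EuclideanSpace ℝ (Fin n)) M] [SecondCountableTopology M] [Nonempty M] :
    ∃ c : ℕ → M, ⋃ k, (chartAt (EuclideanSpace ℝ (Fin n)) (c k)).source = univ := by
  obtain ⟨s, hs, hU⟩ := TopologicalSpace.countable_cover_nhds
    (fun x : M => chart_source_mem_nhds (EuclideanSpace ℝ (Fin n)) x)
  have hne : s.Nonempty := by
    by_contra h
    rw [not_nonempty_iff_eq_empty] at h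
    simp only [h, biUnion_empty] at hU
    exact empty_ne_univ hU
  obtain ⟨c, rfl⟩ := hs.exists_eq_range hne
  exact ⟨c, by simpa using hU⟩

variable {n : ℕ} {M : Type*} [EMetricSpace M] [ChartedSpace (EuclideanSpace ℝ (Fin n)) M]
  [RiemannianBundle (fun x : M => TangentSpace (𝓡 n) x)]

/-! ### The metric, vector fields and the volume in a chart -/

/-- The Gram matrix `g_ij = ⟨∂_i, ∂_j⟩` of the metric in the chart `φ`, at the point of `M` with
coordinates `z`. -/
def gram (φ : OpenPartialHomeomorph M (EuclideanSpace ℝ (Fin n)))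
    (z : EuclideanSpace ℝ (Fin n)) : Matrix (Fin n) (Fin n) ℝ :=
  Matrix.of fun i j =>
    inner ℝ
      (mfderiv (𝓡 n) (𝓡 n) φ.symm z (EuclideanSpace.single i (1 : ℝ)) :
        TangentSpace (𝓡 n) (φ.symm z))
      (mfderiv (𝓡 n) (𝓡 n) φ.symm z (EuclideanSpace.single j (1 : ℝ)) :
        TangentSpace (𝓡 n) (φ.symm z))

/-- The density `√(det g_ij)` of the Riemannian volume in the chart `φ`. -/
def volDensity (φ : OpenPartialHomeomorph M (EuclideanSpace ℝ (Fin n)))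
    (z : EuclideanSpace ℝ (Fin n)) : ℝ :=
  Real.sqrt (gram φ z).det

/-- The components of the vector field `X` in the chart `φ`, as a function of the coordinates. -/
def chartField (φ : OpenPartialHomeomorph M (EuclideanSpace ℝ (Fin n)))
    (X : ∀ x : M, TangentSpace (𝓡 n) x) (z : EuclideanSpace ℝ (Fin n)) :
    EuclideanSpace ℝ (Fin n) :=
  mfderiv (𝓡 n) (𝓡 n) φ (φ.symm z) (X (φ.symm z))

/-- The measure on `M` which in the chart `φ` is `√(det g_ij) dz`, and which is carried by the
domain of `φ`. -/
def chartVolume [MeasurableSpace M] (φ : OpenPartialHomeomorph M (EuclideanSpace ℝ (Fin n))) :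
    Measure M :=
  ((volume.restrict φ.target).withDensity fun z => ENNReal.ofReal (volDensity φ z)).map φ.symm

variable (n M) in
/-- Centres of a sequence of charts which cover `M`. -/
def chartCentre [SecondCountableTopology M] [Nonempty M] : ℕ → M :=
  (exists_chart_cover n M).choose

variable (n M) in
/-- The Riemannian volume measure: `M` is cut into countably many disjoint measurable pieces, each
inside the domain of a chart, and on each piece the measure is `√(det g_ij) dz`. (By the change of
variables formula the result does not depend on the charts or on the pieces.) -/
def riemannianVolume [MeasurableSpace M] [SecondCountableTopology M] [Nonempty M] : Measure M :=
  Measure.sum fun k =>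
    (chartVolume (chartAt (EuclideanSpace ℝ (Fin n)) (chartCentre n M k))).restrict
      (disjointed
        (fun j => (chartAt (EuclideanSpace ℝ (Fin n)) (chartCentre n M j)).source) k)

/-! ### Gradient, divergence, `p`-Laplacian -/

/-- The Riemannian gradient: `⟨∇f(x), v⟩ = df_x(v)` for all tangent vectors `v` at `x`. -/
def grad (f : M → ℝ) (x : M) : TangentSpace (𝓡 n) x :=
  haveI : FiniteDimensional ℝ (TangentSpace (𝓡 n) x) :=
    inferInstanceAs (FiniteDimensional ℝ (EuclideanSpace ℝ (Fin n)))
  haveI : CompleteSpace (TangentSpace (𝓡 n) x) := FiniteDimensional.complete ℝ _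
  (InnerProductSpace.toDual ℝ (TangentSpace (𝓡 n) x)).symm (mfderiv (𝓡 n) 𝓘(ℝ, ℝ) f x)

/-- The divergence `(det g)^(-1/2) ∑ i, ∂_i ((det g)^(1/2) X^i)`, computed at `x` in the
preferred chart at `x`. -/
def divergence (X : ∀ x : M, TangentSpace (𝓡 n) x) (x : M) : ℝ :=
  let φ := chartAt (EuclideanSpace ℝ (Fin n)) x
  (∑ i : Fin n,
    (fderiv ℝ (fun z => volDensity φ z • chartField φ X z) (φ x)
      (EuclideanSpace.single i (1 : ℝ))) i) / volDensity φ (φ x)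

/-- The vector field `‖∇f‖^(p-2) ∇f` (equal to `0` where `∇f = 0`). -/
def pField (p : ℝ) (f : M → ℝ) (x : M) : TangentSpace (𝓡 n) x :=
  ‖grad (n := n) f x‖ ^ (p - 2) • grad f x

variable (n) in
/-- The `p`-Laplacian `Δ_p f = div (‖∇f‖^(p-2) ∇f)`. -/
def pLaplacian (p : ℝ) (f : M → ℝ) (x : M) : ℝ :=
  divergence (n := n) (pField p f) x

/-! ### Test functions, Sobolev functions, the first eigenvalue -/

variable [IsManifold (𝓡 n) ∞ M]

variable (n) in
/-- `φ ∈ C_c^∞(Ω)`. -/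
structure IsTestFunction (Ω : Set M) (φ : M → ℝ) : Prop where
  smooth : ContMDiff (𝓡 n) 𝓘(ℝ, ℝ) ∞ φ
  compact : HasCompactSupport φ
  support : tsupport φ ⊆ Ω

/-- `Y` is a smooth vector field with compact support in `Ω`. -/
structure IsTestField (Ω : Set M) (Y : ∀ x : M, TangentSpace (𝓡 n) x) : Prop where
  smooth : ContMDiff (𝓡 n) (𝓡 n).tangent ∞
    (fun x => (⟨x, Y x⟩ : TangentBundle (𝓡 n) M))
  compact : IsCompact (closure {x | Y x ≠ 0})
  support : closure {x | Y x ≠ 0} ⊆ Ω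

/-- A vector field on `Ω` is measurable (up to null sets) when its components in the charts are. -/
def AEMeasurableField (Ω : Set M) (X : ∀ x : M, TangentSpace (𝓡 n) x) : Prop :=
  ∀ c : M, AEMeasurable (chartField (chartAt (EuclideanSpace ℝ (Fin n)) c) X)
    (volume.restrict ((chartAt (EuclideanSpace ℝ (Fin n)) c).target ∩
      (chartAt (EuclideanSpace ℝ (Fin n)) c).symm ⁻¹' Ω))

section Volume

variable [MeasurableSpace M] [SecondCountableTopology M] [Nonempty M]

/-- `G` is the weak gradient of `u` on `Ω`: `∫_Ω u div Y = - ∫_Ω ⟨G, Y⟩` for all smooth vector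
fields `Y` with compact support in `Ω`. -/
def IsWeakGradient (Ω : Set M) (u : M → ℝ) (G : ∀ x : M, TangentSpace (𝓡 n) x) : Prop :=
  ∀ Y : ∀ x : M, TangentSpace (𝓡 n) x, IsTestField Ω Y →
    ∫ x in Ω, u x * divergence Y x ∂(riemannianVolume n M) =
      -∫ x in Ω, inner ℝ (G x) (Y x) ∂(riemannianVolume n M)

/-- `u ∈ W_0^{1,p}(Ω)` with weak gradient `G`: both are in `L^p(Ω)`, and `u` is the limit
in `W^{1,p}(Ω)` of functions in `C_c^∞(Ω)`. -/
structure IsW01p (p : ℝ) (Ω : Set M) (u : M → ℝ) (G : ∀ x : M, TangentSpace (𝓡 n) x) :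
    Prop where
  memLp : MemLp u (ENNReal.ofReal p) ((riemannianVolume n M).restrict Ω)
  aemeasurable_grad : AEMeasurableField Ω G
  grad_lt_top : ∫⁻ x in Ω, ‖G x‖ₑ ^ p ∂(riemannianVolume n M) < ⊤
  isWeakGradient : IsWeakGradient Ω u G
  exists_approx : ∃ φ : ℕ → M → ℝ, (∀ k, IsTestFunction n Ω (φ k)) ∧
    Tendsto (fun k => ∫⁻ x in Ω, ‖φ k x - u x‖ₑ ^ p ∂(riemannianVolume n M)) atTop (𝓝 0) ∧
    Tendsto (fun k => ∫⁻ x in Ω, ‖grad (φ k) x - G x‖ₑ ^ p ∂(riemannianVolume n M)) atTop (𝓝 0)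

variable (n) in
/-- The first Dirichlet eigenvalue of the `p`-Laplacian on `Ω`: the infimum of the quotients
`∫_Ω ‖∇u‖^p / ∫_Ω |u|^p` over the `u ∈ W_0^{1,p}(Ω)` which are not almost everywhere zero. -/
def firstEigenvalue (p : ℝ) (Ω : Set M) : ℝ≥0∞ :=
  ⨅ (u : M → ℝ) (G : ∀ x : M, TangentSpace (𝓡 n) x) (_ : IsW01p p Ω u G)
    (_ : ¬ u =ᵐ[(riemannianVolume n M).restrict Ω] 0),
    (∫⁻ x in Ω, ‖G x‖ₑ ^ p ∂(riemannianVolume n M)) /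
      ∫⁻ x in Ω, ‖u x‖ₑ ^ p ∂(riemannianVolume n M)

variable (n) in
/-- `lam` is a Dirichlet eigenvalue of the `p`-Laplacian on `Ω`: the problem
`Δ_p u + lam |u|^(p-2) u = 0` in `Ω`, `u = 0` on `∂Ω` has a weak solution `u ∈ W_0^{1,p}(Ω)` which
is not almost everywhere zero. -/
def IsDirichletEigenvalue (p : ℝ) (Ω : Set M) (lam : ℝ) : Prop :=
  ∃ (u : M → ℝ) (G : ∀ x : M, TangentSpace (𝓡 n) x), IsW01p p Ω u G ∧
    (¬ u =ᵐ[(riemannianVolume n M).restrict Ω] 0) ∧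
    ∀ (v : M → ℝ) (H : ∀ x : M, TangentSpace (𝓡 n) x), IsW01p p Ω v H →
      ∫ x in Ω, ‖G x‖ ^ (p - 2) * inner ℝ (G x) (H x) ∂(riemannianVolume n M) =
        lam * ∫ x in Ω, |u x| ^ (p - 2) * u x * v x ∂(riemannianVolume n M)

variable (n) in
/-- `Δ_p f ≥ b` on `Ω` in the weak sense: `b ∫_Ω φ ≤ - ∫_Ω ⟨‖∇f‖^(p-2) ∇f, ∇φ⟩` for all
nonnegative `φ ∈ C_c^∞(Ω)`. -/
def WeakPLaplacianGE (p : ℝ) (Ω : Set M) (f : M → ℝ) (b : ℝ) : Prop :=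
  ∀ φ : M → ℝ, IsTestFunction n Ω φ → (∀ x, 0 ≤ φ x) →
    b * ∫ x in Ω, φ x ∂(riemannianVolume n M) ≤
      -∫ x in Ω, inner ℝ (pField (n := n) p f x) (grad φ x) ∂(riemannianVolume n M)

end Volume

end RiemannianPLaplacian

end

open RiemannianPLaplacian

namespace RiemannianPLaplacian

/-! The argument is of Barta type: test `Δ_p f ≥ b` with `|φ|^p`, for `φ` in `C_c^∞(Ω)`. Since `‖∇f‖
≤ a`, the field `‖∇f‖^(p-2) ∇f` has norm at most `a^(p-1)`, so `b ∫ |φ|^p ≤ p a^(p-1) ∫ |φ|^(p-1)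
‖∇φ‖ ≤ p a^(p-1) (∫ |φ|^p)^((p-1)/p) (∫ ‖∇φ‖^p)^(1/p)` by Cauchy–Schwarz and Hölder. Cancelling a
power of `∫ |φ|^p` and raising to the power `p` gives the bound for `φ`
(`mul_integral_abs_rpow_le`). As `|φ|^p` need not be smooth, `(φ² + ε²)^(p/2) - ε^p` is used in its
place and `ε → 0`. Density carries the inequality to `W_0^{1,p}`
(`mul_lintegral_enorm_rpow_le_of_isW01p`), which bounds the infimum; testing the eigenvalue equation
with `u` itself bounds every eigenvalue.

The longer half reduces the pointwise hypothesis to the weak one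
(`weakPLaplacianGE_of_le_pLaplacian`). At each point the divergence is computed in the preferred
chart there, and its derivatives need not be continuous or integrable. Three facts settle this. A
positive lower bound excludes the default value `0` of the derivative, so the field is
differentiable. Piola's identity then transports the bound to one fixed chart. There the divergence
theorem for a gauge integral needs no integrability of the divergence. A partition of unity glues
the charts. -/

/-- The coordinate space. -/
abbrev Coord (n : ℕ) : Type := EuclideanSpace ℝ (Fin n)

/-! ### Traces of endomorphisms -/

section Trace

variable {E : Type*} [NormedAddCommGroup E] [NormedSpace ℝ E]

/-- The trace of a continuous endomorphism. -/
noncomputable def clmTrace (A : E →L[ℝ] E) : ℝ :=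
  LinearMap.trace ℝ E A.toLinearMap

theorem clmTrace_eq_sum {n : ℕ} (A : Coord n →L[ℝ] Coord n) :
    clmTrace A = ∑ i, A (EuclideanSpace.single i (1 : ℝ)) i := by
  rw [clmTrace, LinearMap.trace_eq_matrix_trace ℝ (EuclideanSpace.basisFun (Fin n) ℝ).toBasis]
  simp [Matrix.trace, LinearMap.toMatrix_apply]

theorem clmTrace_mul_comm (A B : E →L[ℝ] E) : clmTrace (A * B) = clmTrace (B * A) :=
  LinearMap.trace_mul_comm ℝ A.toLinearMap B.toLinearMap

theorem clmTrace_smulRight [FiniteDimensional ℝ E] (f : E →L[ℝ] ℝ) (x : E) :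
    clmTrace (f.smulRight x) = f x :=
  LinearMap.trace_smulRight f.toLinearMap x

theorem clmTrace_add (A B : E →L[ℝ] E) : clmTrace (A + B) = clmTrace A + clmTrace B := by
  simp [clmTrace]

theorem clmTrace_neg (A : E →L[ℝ] E) : clmTrace (-A) = -clmTrace A := by simp [clmTrace]

theorem clmTrace_smul (c : ℝ) (A : E →L[ℝ] E) : clmTrace (c • A) = c * clmTrace A := by
  simp [clmTrace]

end Trace

/-! ### Derivative of the determinant and Piola's identity -/

section Piola

variable {E : Type*} [NormedAddCommGroup E] [NormedSpace ℝ E] [FiniteDimensional ℝ E]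

theorem differentiable_clm_det : Differentiable ℝ (fun A : E →L[ℝ] E => A.det) := by
  have h : (fun A : E →L[ℝ] E => A.det) =
      fun A => (Matrix.of fun i j => LinearMap.toContinuousLinearMap
        ((Module.finBasis ℝ E).coord i) (A (Module.finBasis ℝ E j))).det := by
    funext A
    rw [ContinuousLinearMap.det, ← LinearMap.det_toMatrix (Module.finBasis ℝ E)]
    congr 1
    ext i j
    simp [LinearMap.toMatrix_apply]
  rw [h]
  simp only [Matrix.det_apply, Matrix.of_apply]
  fun_prop

/-- In matrix form, `det (1 + tH) = 1 + t tr H + t² r(t)` with `r` a polynomial, so only the linear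
coefficient survives at `0`. -/
theorem hasDerivAt_det_one_add_smul (H : E →L[ℝ] E) :
    HasDerivAt (fun t : ℝ => (1 + t • H).det) (clmTrace H) 0 := by
  set b := Module.finBasis ℝ E
  set N := LinearMap.toMatrix b b H.toLinearMap
  have h : (fun t : ℝ => (1 + t • H).det) =
      fun t => 1 + N.trace * t +
        ((Matrix.det (1 + (Polynomial.X : Polynomial ℝ) • N.map Polynomial.C)).divX.divX).eval t
          * t ^ 2 := by
    funext t
    rw [← Matrix.det_one_add_smul, ContinuousLinearMap.det, ← LinearMap.det_toMatrix b]
    congr 1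
    have : (1 + t • H : E →L[ℝ] E).toLinearMap = LinearMap.id + t • H.toLinearMap := rfl
    rw [this, map_add, LinearMap.toMatrix_id, map_smul]
  rw [h, clmTrace, LinearMap.trace_eq_matrix_trace ℝ b]
  have h1 := (((hasDerivAt_id (0 : ℝ)).const_mul N.trace).const_add 1).add
    ((Polynomial.hasDerivAt (Matrix.det
      (1 + (Polynomial.X : Polynomial ℝ) • N.map Polynomial.C)).divX.divX (0 : ℝ)).mul
      ((hasDerivAt_id (0 : ℝ)).pow 2))
  exact h1.congr_deriv (by simp [N, b])

/-- Jacobi's formula, from the factorisation `A + tH = A (1 + t A⁻¹ H)` and the derivative at the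
identity. -/
theorem fderiv_clm_det_apply (A : (E →L[ℝ] E)ˣ) (H : E →L[ℝ] E) :
    fderiv ℝ (fun A : E →L[ℝ] E => A.det) A H =
      (A : E →L[ℝ] E).det * clmTrace ((↑A⁻¹ : E →L[ℝ] E) * H) := by
  have h1 : HasDerivAt (fun t : ℝ => ((A : E →L[ℝ] E) + t • H).det)
      (fderiv ℝ (fun A : E →L[ℝ] E => A.det) A H) 0 := by
    have h2 : HasDerivAt (fun t : ℝ => (A : E →L[ℝ] E) + t • H) H 0 := by
      simpa using ((hasDerivAt_id (0 : ℝ)).smul_const H).const_add (A : E →L[ℝ] E)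
    have h3 := (differentiable_clm_det (E := E)
      ((A : E →L[ℝ] E) + (0 : ℝ) • H)).hasFDerivAt.comp_hasDerivAt _ h2
    rwa [zero_smul, add_zero] at h3
  refine h1.unique ?_
  refine ((hasDerivAt_det_one_add_smul ((↑A⁻¹ : E →L[ℝ] E) * H)).const_mul
    (A : E →L[ℝ] E).det).congr_of_eventuallyEq (Eventually.of_forall fun t => ?_)
  have : (A : E →L[ℝ] E) + t • H = A * (1 + t • ((↑A⁻¹ : E →L[ℝ] E) * H)) := by
    rw [mul_add, mul_one, mul_smul_comm, Units.mul_inv_cancel_left]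
  simp only [this]
  exact LinearMap.det_comp _ _

/-- Piola's identity: pulling back the vector field `V` by `τ`, as a vector density, multiplies its
divergence by the Jacobian determinant. -/
theorem exists_hasFDerivAt_piola {A : E → E →L[ℝ] E} {A' : E →L[ℝ] E →L[ℝ] E} {V τ : E → E}
    {V' : E →L[ℝ] E} {z : E}
    (hA : HasFDerivAt A A' z) (hsymm : ∀ h k, A' h k = A' k h) (hτ : HasFDerivAt τ (A z) z)
    (hV : HasFDerivAt V V' (τ z)) (hu : IsUnit (A z)) :
    ∃ W' : E →L[ℝ] E,
      HasFDerivAt (fun y => (A y).det • Ring.inverse (A y) (V (τ y))) W' z ∧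
      clmTrace W' = (A z).det * clmTrace V' := by
  have : CompleteSpace E := FiniteDimensional.complete ℝ E
  obtain ⟨u, hu⟩ := hu
  have hdet := (differentiable_clm_det (E := E) (A z)).hasFDerivAt.comp z hA
  have h0 := hasFDerivAt_ringInverse (𝕜 := ℝ) u
  rw [hu] at h0
  have hinv := h0.comp z hA
  have hW := hdet.smul (hinv.clm_apply (hV.comp z hτ))
  refine ⟨_, hW, ?_⟩
  set B : E →L[ℝ] E := ↑u⁻¹ with hB
  set v := B (V (τ z)) with hv
  have hBA : Ring.inverse (A z) = B := by rw [← hu, Ring.inverse_unit]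
  have hW' : ∀ h, ((fderiv ℝ (fun A : E →L[ℝ] E => A.det) (A z)).comp A') h =
      (A z).det * clmTrace (B * A' h) := by
    intro h
    rw [ContinuousLinearMap.comp_apply, ← hu]
    exact fderiv_clm_det_apply u (A' h)
  have hcomm : clmTrace (B * V' * A z) = clmTrace V' := by
    rw [clmTrace_mul_comm, ← mul_assoc, ← hu, hB, Units.mul_inv, one_mul]
  -- The product rule gives three terms. Differentiating `A⁻¹` gives `h ↦ -A⁻¹ (A' h) v`, which by
  -- symmetry of `A'` is `h ↦ -A⁻¹ (A' v) h`. Its trace cancels the one from differentiating the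
  -- determinant, and only the conjugate of `V'` is left.
  have htr : clmTrace ((A z).det • (B * V' * A z) + -((A z).det • (B * A' v)) +
      ((fderiv ℝ (fun A : E →L[ℝ] E => A.det) (A z)).comp A').smulRight v) =
      (A z).det * clmTrace V' := by
    rw [clmTrace_add, clmTrace_add, clmTrace_neg, clmTrace_smul, clmTrace_smul,
      clmTrace_smulRight, hW', hcomm]
    ring
  rw [← htr]
  congr 1
  simp only [Function.comp_apply, hBA]
  ext h : 1
  simp [← hv, hsymm h v]

end Piola

/-! ### A divergence inequality in Euclidean space -/

/-- If a compactly supported field is differentiable at every point and its divergence is bounded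
below by a continuous function with compact support, the integral of that function is nonpositive.
The divergence itself need not be integrable. -/
theorem integral_nonpos_of_le_clmTrace_fderiv {n : ℕ} {F : Coord n → Coord n} {q : Coord n → ℝ}
    (hF : Differentiable ℝ F) (hFc : HasCompactSupport F) (hq : Continuous q)
    (hqc : HasCompactSupport q) (hle : ∀ z, q z ≤ clmTrace (fderiv ℝ F z)) :
    ∫ z, q z ≤ 0 := by
  simp only [clmTrace_eq_sum] at hle
  cases n with
  | zero => exact integral_nonpos fun z => by simpa using hle z
  | succ n =>
    let T := EuclideanSpace.equiv (Fin (n + 1)) ℝ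
    let Φ : (Fin (n + 1) → ℝ) → Fin (n + 1) → ℝ := fun y => T (F (T.symm y))
    have hΦ : ∀ y, HasFDerivAt Φ ((T : Coord (n+1) →L[ℝ] (Fin (n+1) → ℝ)) ∘L
        (fderiv ℝ F (T.symm y)) ∘L (T.symm : (Fin (n+1) → ℝ) →L[ℝ] Coord (n+1))) y := fun y =>
      T.hasFDerivAt.comp y ((hF _).hasFDerivAt.comp y T.symm.hasFDerivAt)
    have hint : ∫ z, q z = ∫ y, q (T.symm y) :=
      ((PiLp.volume_preserving_toLp (Fin (n + 1))).integral_comp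
        (MeasurableEquiv.toLp 2 _).measurableEmbedding q).symm
    obtain ⟨R, hR⟩ : ∃ R : ℝ, ∀ z, (F z ≠ 0 ∨ q z ≠ 0) → ‖z‖ < R := by
      obtain ⟨R₁, h₁⟩ := hFc.isCompact.isBounded.subset_ball 0
      obtain ⟨R₂, h₂⟩ := hqc.isCompact.isBounded.subset_ball 0
      refine ⟨max R₁ R₂, fun z hz => ?_⟩
      rcases hz with hz | hz
      · exact lt_max_of_lt_left (by simpa using h₁ (subset_tsupport _ hz))
      · exact lt_max_of_lt_right (by simpa using h₂ (subset_tsupport _ hz))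
    -- The maximum with `1` makes the cube nondegenerate even if `R ≤ 0`; both supports lie strictly
    -- inside it.
    have hR0 : (0 : ℝ) < max R 1 := lt_max_of_lt_right one_pos
    let I : BoxIntegral.Box (Fin (n + 1)) :=
      ⟨fun _ => -max R 1, fun _ => max R 1, fun _ => by linarith⟩
    have hcoord : ∀ y : Fin (n + 1) → ℝ, (F (T.symm y) ≠ 0 ∨ q (T.symm y) ≠ 0) →
        ∀ i, |y i| < max R 1 := by
      intro y hy i
      exact lt_max_of_lt_left ((PiLp.norm_apply_le (T.symm y) i).trans_lt (hR _ hy))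
    -- The `GP` gauge integral integrates the divergence of any everywhere differentiable field. On
    -- the continuous function `q` it agrees with the Lebesgue integral, so the two can be compared.
    have hdiv := BoxIntegral.hasIntegral_GP_divergence_of_forall_hasDerivWithinAt I Φ _ ∅
      countable_empty (by simp) (fun y _ => (hΦ y).hasFDerivWithinAt)
    have hface : ∀ (i : Fin (n + 1)) (x : Fin n → ℝ) (t : ℝ), |t| = max R 1 →
        Φ (i.insertNth t x) i = 0 := by
      intro i x t ht
      by_contra h
      have h2 : F (T.symm (i.insertNth t x : Fin (n + 1) → ℝ)) ≠ 0 := fun h0 => h (by simp [Φ, h0])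
      have := hcoord _ (Or.inl h2) i
      rw [Fin.insertNth_apply_same, ht] at this
      exact lt_irrefl _ this
    have hu : ∀ (i : Fin (n + 1)) (x : Fin n → ℝ), Φ (i.insertNth (I.upper i) x) i = 0 :=
      fun i x => hface i x _ (abs_of_pos hR0)
    have hl : ∀ (i : Fin (n + 1)) (x : Fin n → ℝ), Φ (i.insertNth (I.lower i) x) i = 0 :=
      fun i x => hface i x _ (by rw [abs_neg, abs_of_pos hR0])
    simp only [hu, hl, BoxIntegral.integral_zero, sub_zero, Finset.sum_const_zero] at hdiv
    have hqI := ContinuousOn.hasBoxIntegral (volume : Measure (Fin (n + 1) → ℝ)) (I := I)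
      (f := fun y => q (T.symm y)) (hq.comp T.symm.continuous).continuousOn
      BoxIntegral.IntegrationParams.GP
    have hsub := (hdiv.sub hqI).integral_eq
    have hnn := BoxIntegral.integral_nonneg (l := BoxIntegral.IntegrationParams.GP) (I := I)
      (g := _ - fun y => q (T.symm y)) (fun y _ => sub_nonneg.2 (hle (T.symm y)))
      (volume : Measure (Fin (n + 1) → ℝ))
    have hnn' : 0 ≤ 0 - ∫ y in (I : Set (Fin (n + 1) → ℝ)), q (T.symm y) := by
      rw [← hsub]
      exact hnn
    have hrestr : ∫ y in (I : Set (Fin (n + 1) → ℝ)), q (T.symm y) = ∫ y, q (T.symm y) := by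
      refine setIntegral_eq_integral_of_forall_compl_eq_zero fun y hy => ?_
      by_contra h
      refine hy fun i => ?_
      have := abs_lt.1 (hcoord y (Or.inr h) i)
      exact ⟨this.1, this.2.le⟩
    rw [hint, ← hrestr]
    linarith

/-! ### Charts and transition maps -/

section Charts

variable {n : ℕ} {M : Type*} [EMetricSpace M] [ChartedSpace (EuclideanSpace ℝ (Fin n)) M]

/-- The derivative of a chart, in the fixed coordinate space. -/
noncomputable def chartD (e : OpenPartialHomeomorph M (EuclideanSpace ℝ (Fin n))) (x : M) :
    Coord n →L[ℝ] Coord n :=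
  mfderiv (𝓡 n) (𝓡 n) e x

/-- The derivative of the inverse of a chart, in the fixed coordinate space. -/
noncomputable def chartDsymm (e : OpenPartialHomeomorph M (EuclideanSpace ℝ (Fin n)))
    (z : Coord n) : Coord n →L[ℝ] Coord n :=
  mfderiv (𝓡 n) (𝓡 n) e.symm z

variable {e e' : OpenPartialHomeomorph M (EuclideanSpace ℝ (Fin n))}

/-- The derivative of `f` at `x` in the direction `v`. -/
noncomputable def dirDeriv (f : M → ℝ) (x : M) (v : Coord n) : ℝ :=
  mfderiv (𝓡 n) 𝓘(ℝ, ℝ) f x v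

theorem dirDeriv_congr {f g : M → ℝ} {x : M} (h : f =ᶠ[𝓝 x] g) (v : Coord n) :
    dirDeriv f x v = dirDeriv g x v :=
  congrArg (fun L : Coord n →L[ℝ] ℝ => L v) h.mfderiv_eq

theorem dirDeriv_const (c : ℝ) (x : M) (v : Coord n) : dirDeriv (fun _ : M => c) x v = 0 :=
  congrArg (fun L : Coord n →L[ℝ] ℝ => L v) (mfderiv_const (I := 𝓡 n) (I' := 𝓘(ℝ, ℝ)))

theorem dirDeriv_add {f g : M → ℝ} {x : M} (hf : MDifferentiableAt (𝓡 n) 𝓘(ℝ, ℝ) f x)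
    (hg : MDifferentiableAt (𝓡 n) 𝓘(ℝ, ℝ) g x) (v : Coord n) :
    dirDeriv (f + g) x v = dirDeriv f x v + dirDeriv g x v :=
  congrArg (fun L : Coord n →L[ℝ] ℝ => L v) (mfderiv_add hf hg)

theorem dirDeriv_comp {f : M → ℝ} {F : ℝ → ℝ} {F' : ℝ} {x : M}
    (hf : MDifferentiableAt (𝓡 n) 𝓘(ℝ, ℝ) f x) (hF : HasDerivAt F F' (f x)) (v : Coord n) :
    dirDeriv (F ∘ f) x v = F' * dirDeriv f x v := by
  have h1 := mfderiv_comp x hF.differentiableAt.mdifferentiableAt hf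
  rw [mfderiv_eq_fderiv] at h1
  have h2 : dirDeriv (F ∘ f) x v = fderiv ℝ F (f x) (dirDeriv f x v) :=
    congrArg (fun L : Coord n →L[ℝ] ℝ => L v) h1
  rw [h2, hF.hasFDerivAt.fderiv]
  simp [mul_comm]

theorem AEMeasurableField.sub [MeasurableSpace M] {Ω : Set M}
    {X Y : ∀ x : M, TangentSpace (𝓡 n) x}
    (hX : AEMeasurableField Ω X) (hY : AEMeasurableField Ω Y) :
    AEMeasurableField Ω fun x => X x - Y x := fun c => by
  refine ((hX c).sub (hY c)).congr (Eventually.of_forall fun z => ?_)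
  exact (map_sub (chartD (chartAt (EuclideanSpace ℝ (Fin n)) c) _) _ _).symm

variable [IsManifold (𝓡 n) ∞ M]

theorem mdifferentiable_chart_of_mem_atlas (he : e ∈ atlas (EuclideanSpace ℝ (Fin n)) M) :
    e.MDifferentiable (𝓡 n) (𝓡 n) :=
  mdifferentiable_of_mem_atlas he

theorem contDiffOn_transition (he : e ∈ atlas (EuclideanSpace ℝ (Fin n)) M)
    (he' : e' ∈ atlas (EuclideanSpace ℝ (Fin n)) M) :
    ContDiffOn ℝ ∞ (e' ∘ e.symm) (e.symm.trans e').source := by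
  have h1 := contMDiffOn_symm_of_mem_maximalAtlas (I := 𝓡 n) (n := ∞)
    (IsManifold.subset_maximalAtlas he)
  have h2 := contMDiffOn_of_mem_maximalAtlas (I := 𝓡 n) (n := ∞)
    (IsManifold.subset_maximalAtlas he')
  rw [← contMDiffOn_iff_contDiffOn]
  refine h2.comp (h1.mono ?_) ?_
  · intro z hz
    simp only [mfld_simps] at hz
    exact hz.1
  · intro z hz
    simp only [mfld_simps] at hz
    exact hz.2

theorem contDiffAt_transition (he : e ∈ atlas (EuclideanSpace ℝ (Fin n)) M)
    (he' : e' ∈ atlas (EuclideanSpace ℝ (Fin n)) M) {z : Coord n} (hz : z ∈ e.target)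
    (hx : e.symm z ∈ e'.source) : ContDiffAt ℝ ∞ (e' ∘ e.symm) z := by
  refine (contDiffOn_transition he he').contDiffAt
    ((e.symm.trans e').open_source.mem_nhds ?_)
  simp only [mfld_simps]
  exact ⟨hz, hx⟩

theorem chartD_comp_chartDsymm (he : e ∈ atlas (EuclideanSpace ℝ (Fin n)) M) {z : Coord n}
    (hz : z ∈ e.target) (v : Coord n) : chartD e (e.symm z) (chartDsymm e z v) = v :=
  congrArg (fun L : Coord n →L[ℝ] Coord n => L v)
    ((mdifferentiable_chart_of_mem_atlas he).comp_symm_deriv hz)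

theorem chartDsymm_comp_chartD (he : e ∈ atlas (EuclideanSpace ℝ (Fin n)) M) {z : Coord n}
    (hz : z ∈ e.target) (v : Coord n) : chartDsymm e z (chartD e (e.symm z) v) = v := by
  have h := congrArg (fun L : Coord n →L[ℝ] Coord n => L v)
    ((mdifferentiable_chart_of_mem_atlas he).symm_comp_deriv (e.map_target hz))
  -- The derivative in `h` is taken at `e (e.symm z)`; a free base point `w` lets it be moved to
  -- `z`.
  have h2 : ∀ w, w = z → chartDsymm e w (chartD e (e.symm z) v) = v →
    chartDsymm e z (chartD e (e.symm z) v) = v := by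
    rintro w rfl h
    exact h
  exact h2 _ (e.right_inv hz) h

theorem chartDsymm_transition (he : e ∈ atlas (EuclideanSpace ℝ (Fin n)) M)
    (he' : e' ∈ atlas (EuclideanSpace ℝ (Fin n)) M) {z : Coord n} (hz : z ∈ e.target)
    (hx : e.symm z ∈ e'.source) (v : Coord n) :
    chartDsymm e z v = chartDsymm e' (e' (e.symm z)) (fderiv ℝ (e' ∘ e.symm) z v) := by
  have h1 : e.symm =ᶠ[𝓝 z] e'.symm ∘ (e' ∘ e.symm) := by
    have : (e.symm.trans e').source ∈ 𝓝 z := (e.symm.trans e').open_source.mem_nhds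
      (by simp only [mfld_simps]; exact ⟨hz, hx⟩)
    filter_upwards [this] with w hw
    simp only [mfld_simps] at hw
    simp [e'.left_inv hw.2]
  have h2 : MDifferentiableAt (𝓡 n) (𝓡 n) (e' ∘ e.symm) z :=
    ((contDiffAt_transition he he' hz hx).differentiableAt (by simp)).mdifferentiableAt
  have h3 : MDifferentiableAt (𝓡 n) (𝓡 n) e'.symm ((e' ∘ e.symm) z) :=
    (mdifferentiable_chart_of_mem_atlas he').mdifferentiableAt_symm (e'.map_source hx)
  have h4 := mfderiv_comp z h3 h2
  rw [← h1.mfderiv_eq, mfderiv_eq_fderiv] at h4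
  exact congrArg (fun L : Coord n →L[ℝ] Coord n => L v) h4

theorem chartD_transition (he : e ∈ atlas (EuclideanSpace ℝ (Fin n)) M)
    (he' : e' ∈ atlas (EuclideanSpace ℝ (Fin n)) M) {z : Coord n} (hz : z ∈ e.target)
    (hx : e.symm z ∈ e'.source) (v : Coord n) :
    chartD e' (e.symm z) v = fderiv ℝ (e' ∘ e.symm) z (chartD e (e.symm z) v) := by
  have h := chartDsymm_transition he he' hz hx (chartD e (e.symm z) v)
  rw [chartDsymm_comp_chartD he hz] at h
  have h2 := chartD_comp_chartDsymm he' (e'.map_source hx)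
    (fderiv ℝ (e' ∘ e.symm) z (chartD e (e.symm z) v))
  rw [← h, e'.left_inv hx] at h2
  exact h2

/-- The inverse is the derivative of `e` composed with that of `e'.symm`. -/
theorem isUnit_fderiv_transition (he : e ∈ atlas (EuclideanSpace ℝ (Fin n)) M)
    (he' : e' ∈ atlas (EuclideanSpace ℝ (Fin n)) M) {z : Coord n} (hz : z ∈ e.target)
    (hx : e.symm z ∈ e'.source) : IsUnit (fderiv ℝ (e' ∘ e.symm) z) := by
  have h1 : ∀ v, fderiv ℝ (e' ∘ e.symm) z (chartD e (e.symm z)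
      (chartDsymm e' (e' (e.symm z)) v)) = v := fun v => by
    rw [← chartD_transition he he' hz hx]
    have := chartD_comp_chartDsymm he' (e'.map_source hx) v
    rwa [e'.left_inv hx] at this
  have h2 : ∀ v, chartD e (e.symm z)
      (chartDsymm e' (e' (e.symm z)) (fderiv ℝ (e' ∘ e.symm) z v)) = v := fun v => by
    rw [← chartDsymm_transition he he' hz hx, chartD_comp_chartDsymm he hz]
  exact ⟨⟨fderiv ℝ (e' ∘ e.symm) z, chartD e (e.symm z) ∘L chartDsymm e' (e' (e.symm z)),
    by ext v : 1; exact h1 v, by ext v : 1; exact h2 v⟩, rfl⟩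

theorem dirDeriv_chartDsymm (he : e ∈ atlas (EuclideanSpace ℝ (Fin n)) M) {f : M → ℝ}
    {z : Coord n} (hz : z ∈ e.target) (hf : MDifferentiableAt (𝓡 n) 𝓘(ℝ, ℝ) f (e.symm z))
    (v : Coord n) :
    dirDeriv f (e.symm z) (chartDsymm e z v) = fderiv ℝ (f ∘ e.symm) z v := by
  have h := mfderiv_comp z hf ((mdifferentiable_chart_of_mem_atlas he).mdifferentiableAt_symm hz)
  rw [mfderiv_eq_fderiv] at h
  exact (congrArg (fun L : Coord n →L[ℝ] ℝ => L v) h).symm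

theorem chartDsymm_chartField (he : e ∈ atlas (EuclideanSpace ℝ (Fin n)) M)
    (X : ∀ x : M, TangentSpace (𝓡 n) x) {z : Coord n} (hz : z ∈ e.target) :
    chartDsymm e z (chartField e X z) = X (e.symm z) :=
  chartDsymm_comp_chartD he hz _

theorem contDiffOn_comp_chart_symm (he : e ∈ atlas (EuclideanSpace ℝ (Fin n)) M) {f : M → ℝ}
    (hf : ContMDiff (𝓡 n) 𝓘(ℝ, ℝ) ∞ f) : ContDiffOn ℝ ∞ (f ∘ e.symm) e.target := by
  rw [← contMDiffOn_iff_contDiffOn]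
  exact hf.comp_contMDiffOn (contMDiffOn_symm_of_mem_maximalAtlas (I := 𝓡 n) (n := ∞)
    (IsManifold.subset_maximalAtlas he))

/-- Written with `Ring.inverse` so that, together with `volDensity_transition`, it matches the
vector density in `exists_hasFDerivAt_piola`. -/
theorem chartField_transition (he : e ∈ atlas (EuclideanSpace ℝ (Fin n)) M)
    (he' : e' ∈ atlas (EuclideanSpace ℝ (Fin n)) M) (X : ∀ x : M, TangentSpace (𝓡 n) x)
    {z : Coord n} (hz : z ∈ e.target) (hx : e.symm z ∈ e'.source) :
    chartField e X z =
      Ring.inverse (fderiv ℝ (e' ∘ e.symm) z) (chartField e' X (e' (e.symm z))) := by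
  obtain ⟨u, hu⟩ := isUnit_fderiv_transition he he' hz hx
  have h1 : chartField e' X (e' (e.symm z)) = chartD e' (e.symm z) (X (e.symm z)) := by
    have : ∀ y, y = e.symm z → chartD e' y (X y) = chartD e' (e.symm z) (X (e.symm z)) := by
      rintro y rfl
      rfl
    exact this _ (e'.left_inv hx)
  have h2 : chartD e' (e.symm z) (X (e.symm z)) =
      fderiv ℝ (e' ∘ e.symm) z (chartField e X z) := chartD_transition he he' hz hx _
  rw [h1, h2, ← hu, Ring.inverse_unit]
  exact (congrArg (fun L : Coord n →L[ℝ] Coord n => L (chartField e X z)) u.inv_mul).symm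

end Charts

/-! ### Gram matrices and the volume density -/

section Metric

variable {n : ℕ} {M : Type*} [EMetricSpace M] [ChartedSpace (EuclideanSpace ℝ (Fin n)) M]
  [RiemannianBundle (fun x : M => TangentSpace (𝓡 n) x)]

/-- The Riemannian metric at `x`, as a bilinear form on the fixed coordinate space. -/
noncomputable def metric (x : M) : Coord n →ₗ[ℝ] Coord n →ₗ[ℝ] ℝ :=
  innerₗ (TangentSpace (𝓡 n) x)

theorem metric_self (x : M) (v : TangentSpace (𝓡 n) x) : metric x v v = ‖v‖ ^ 2 :=
  real_inner_self_eq_norm_sq v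

theorem metric_comm (x : M) (v w : Coord n) : metric x v w = metric x w v :=
  real_inner_comm (F := TangentSpace (𝓡 n) x) w v

theorem metric_self_pos (x : M) {v : Coord n} (hv : v ≠ 0) : 0 < metric x v v :=
  (real_inner_self_pos (F := TangentSpace (𝓡 n) x)).2 hv

variable {e e' : OpenPartialHomeomorph M (EuclideanSpace ℝ (Fin n))}

theorem gram_apply (e : OpenPartialHomeomorph M (EuclideanSpace ℝ (Fin n))) (z : Coord n)
    (i j : Fin n) : gram e z i j = metric (e.symm z)
      (chartDsymm e z (EuclideanSpace.single i 1)) (chartDsymm e z (EuclideanSpace.single j 1)) :=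
  rfl

theorem metric_chartDsymm (e : OpenPartialHomeomorph M (EuclideanSpace ℝ (Fin n)))
    (z v w : Coord n) :
    metric (e.symm z) (chartDsymm e z v) (chartDsymm e z w) =
      ∑ i, ∑ j, v i * w j * gram e z i j := by
  have hv : ∀ v : Coord n, v = ∑ i, v i • EuclideanSpace.single i (1 : ℝ) := fun v => by
    simpa using ((EuclideanSpace.basisFun (Fin n) ℝ).sum_repr v).symm
  conv_lhs => rw [hv v, hv w]
  simp only [map_sum, map_smul, LinearMap.sum_apply, LinearMap.smul_apply, gram_apply, smul_eq_mul]
  simp only [Finset.mul_sum]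
  rw [Finset.sum_comm]
  refine Finset.sum_congr rfl fun i _ => Finset.sum_congr rfl fun j _ => ?_
  ring

theorem gram_posDef [IsManifold (𝓡 n) ∞ M] (he : e ∈ atlas (EuclideanSpace ℝ (Fin n)) M)
    {z : Coord n} (hz : z ∈ e.target) : (gram e z).PosDef := by
  refine Matrix.PosDef.of_dotProduct_mulVec_pos ?_ fun x hx => ?_
  · ext i j
    simp only [Matrix.conjTranspose_apply, gram_apply, star_trivial]
    exact metric_comm _ _ _
  · have h1 : chartDsymm e z (WithLp.toLp 2 x) ≠ 0 := by
      intro h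
      have := chartD_comp_chartDsymm he hz (WithLp.toLp 2 x)
      rw [h, map_zero] at this
      exact hx (by simpa using congrArg WithLp.ofLp this.symm)
    have h2 := metric_self_pos (e.symm z) h1
    rw [metric_chartDsymm] at h2
    refine h2.trans_eq ?_
    simp only [dotProduct, Matrix.mulVec, Finset.mul_sum]
    refine Finset.sum_congr rfl fun i _ => Finset.sum_congr rfl fun j _ => ?_
    rw [Pi.star_apply, star_trivial]
    ring

theorem gram_transition [IsManifold (𝓡 n) ∞ M] (he : e ∈ atlas (EuclideanSpace ℝ (Fin n)) M)
    (he' : e' ∈ atlas (EuclideanSpace ℝ (Fin n)) M) {z : Coord n} (hz : z ∈ e.target)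
    (hx : e.symm z ∈ e'.source) :
    gram e z = (LinearMap.toMatrix (EuclideanSpace.basisFun (Fin n) ℝ).toBasis
        (EuclideanSpace.basisFun (Fin n) ℝ).toBasis
        (fderiv ℝ (e' ∘ e.symm) z).toLinearMap).transpose * gram e' (e' (e.symm z)) *
      LinearMap.toMatrix (EuclideanSpace.basisFun (Fin n) ℝ).toBasis
        (EuclideanSpace.basisFun (Fin n) ℝ).toBasis
        (fderiv ℝ (e' ∘ e.symm) z).toLinearMap := by
  ext i j
  rw [gram_apply, chartDsymm_transition he he' hz hx, chartDsymm_transition he he' hz hx]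
  have h := metric_chartDsymm e' (e' (e.symm z))
    (fderiv ℝ (e' ∘ e.symm) z (EuclideanSpace.single i 1))
    (fderiv ℝ (e' ∘ e.symm) z (EuclideanSpace.single j 1))
  rw [e'.left_inv hx] at h
  rw [h]
  simp only [Matrix.mul_apply, Matrix.transpose_apply, LinearMap.toMatrix_apply, Finset.sum_mul]
  rw [Finset.sum_comm]
  refine Finset.sum_congr rfl fun k _ => Finset.sum_congr rfl fun l _ => ?_
  simp
  ring

/-- The Gram matrix changes by congruence `Jᵀ G J`, so its determinant gains `(det J)²`, whose root
is `|det J|`. -/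
theorem volDensity_transition [IsManifold (𝓡 n) ∞ M]
    (he : e ∈ atlas (EuclideanSpace ℝ (Fin n)) M)
    (he' : e' ∈ atlas (EuclideanSpace ℝ (Fin n)) M) {z : Coord n} (hz : z ∈ e.target)
    (hx : e.symm z ∈ e'.source) :
    volDensity e z = |(fderiv ℝ (e' ∘ e.symm) z).det| * volDensity e' (e' (e.symm z)) := by
  rw [volDensity, gram_transition he he' hz hx, Matrix.det_mul, Matrix.det_mul,
    Matrix.det_transpose, LinearMap.det_toMatrix, volDensity, ← Real.sqrt_sq_eq_abs,
    ← Real.sqrt_mul (sq_nonneg _)]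
  congr 1
  rw [ContinuousLinearMap.det]
  ring

theorem volDensity_pos [IsManifold (𝓡 n) ∞ M] (he : e ∈ atlas (EuclideanSpace ℝ (Fin n)) M)
    {z : Coord n} (hz : z ∈ e.target) : 0 < volDensity e z :=
  Real.sqrt_pos.2 (gram_posDef he hz).det_pos

variable [IsManifold (𝓡 n) ∞ M]
  [IsContMDiffRiemannianBundle (𝓡 n) ∞ (EuclideanSpace ℝ (Fin n))
      (fun x : M => TangentSpace (𝓡 n) x)]

/-- Each coordinate field is the tangent map of `e.symm` applied to a constant field, hence
continuous into the tangent bundle, and the metric is continuous on that bundle. -/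
theorem continuousOn_gram (he : e ∈ atlas (EuclideanSpace ℝ (Fin n)) M) (i j : Fin n) :
    ContinuousOn (fun z => gram e z i j) e.target := by
  have h1 := (contMDiffOn_symm_of_mem_maximalAtlas (I := 𝓡 n) (n := ∞)
    (IsManifold.subset_maximalAtlas he)).continuousOn_tangentMapWithin (by simp)
    e.open_target.uniqueMDiffOn
  have h2 : ∀ v : Coord n, ContinuousOn
      (fun z => (⟨e.symm z, mfderiv (𝓡 n) (𝓡 n) e.symm z v⟩ : TangentBundle (𝓡 n) M))
      e.target := by
    intro v
    have h3 : Continuous fun z : Coord n => (⟨z, v⟩ : TangentBundle (𝓡 n) (Coord n)) := by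
      exact (tangentBundleModelSpaceHomeomorph (𝓡 n)).symm.continuous.comp
        (Continuous.prodMk_left v)
    refine (h1.comp h3.continuousOn fun z hz => hz).congr fun z hz => ?_
    simp only [Function.comp, tangentMapWithin]
    rw [mfderivWithin_of_isOpen e.open_target hz]
  obtain ⟨g, hg, hg'⟩ := IsContMDiffRiemannianBundle.exists_contMDiff (IB := 𝓡 n) (n := ∞)
    (F := EuclideanSpace ℝ (Fin n)) (E := fun x : M => TangentSpace (𝓡 n) x)
  have : IsContinuousRiemannianBundle (EuclideanSpace ℝ (Fin n))
      (fun x : M => TangentSpace (𝓡 n) x) := ⟨g, hg.continuous, hg'⟩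
  exact ContinuousOn.inner_bundle (h2 _) (h2 _)

theorem continuousOn_volDensity (he : e ∈ atlas (EuclideanSpace ℝ (Fin n)) M) :
    ContinuousOn (volDensity e) e.target := by
  refine Real.continuous_sqrt.comp_continuousOn ?_
  simp only [Matrix.det_apply]
  refine continuousOn_finsetSum _ fun σ _ => ?_
  refine ContinuousOn.const_smul (continuousOn_finsetProd _ fun i _ => continuousOn_gram he _ _) _

end Metric

theorem measurableSet_inter_preimage_of_continuousOn {X Y : Type*} [TopologicalSpace X]
    [MeasurableSpace X] [OpensMeasurableSpace X] [TopologicalSpace Y] [MeasurableSpace Y]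
    [BorelSpace Y] {f : X → Y} {s : Set X} {A : Set Y} (hf : ContinuousOn f s)
    (hs : MeasurableSet s) (hA : MeasurableSet A) : MeasurableSet (s ∩ f ⁻¹' A) := by
  have h : Measurable (s.domRestrict f) := (continuousOn_iff_continuous_domRestrict.1 hf).measurable
  have h2 := hs.subtype_image (h hA)
  convert h2 using 1
  ext x
  simp [and_comm]

/-! ### The Riemannian volume in charts -/

section Volume

variable {n : ℕ} {M : Type*} [EMetricSpace M] [ChartedSpace (EuclideanSpace ℝ (Fin n)) M]
  [RiemannianBundle (fun x : M => TangentSpace (𝓡 n) x)]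
  [MeasurableSpace M] [BorelSpace M]
  {e e' : OpenPartialHomeomorph M (EuclideanSpace ℝ (Fin n))}

theorem aemeasurable_chart_symm (e : OpenPartialHomeomorph M (EuclideanSpace ℝ (Fin n))) :
    AEMeasurable e.symm
      ((volume.restrict e.target).withDensity fun z => ENNReal.ofReal (volDensity e z)) :=
  (e.symm.continuousOn.aemeasurable e.open_target.measurableSet).mono_ac
    (withDensity_absolutelyContinuous _ _)

theorem chartVolume_apply (e : OpenPartialHomeomorph M (EuclideanSpace ℝ (Fin n))) {A : Set M}
    (hA : MeasurableSet A) :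
    chartVolume e A = ∫⁻ z in e.target ∩ e.symm ⁻¹' A, ENNReal.ofReal (volDensity e z) := by
  rw [chartVolume, Measure.map_apply_of_aemeasurable (aemeasurable_chart_symm e) hA,
    withDensity_apply', Measure.restrict_restrict' e.open_target.measurableSet, inter_comm]

theorem chartVolume_apply_inter_source
    (e : OpenPartialHomeomorph M (EuclideanSpace ℝ (Fin n))) {A : Set M}
    (hA : MeasurableSet A) : chartVolume e (A ∩ e.source) = chartVolume e A := by
  rw [chartVolume_apply e hA, chartVolume_apply e (hA.inter e.open_source.measurableSet)]
  congr 2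
  ext z
  simp only [mem_inter_iff, mem_preimage]
  exact ⟨fun h => ⟨h.1, h.2.1⟩, fun h => ⟨h.1, h.2, e.map_target h.1⟩⟩

variable [IsManifold (𝓡 n) ∞ M]

/-- The Jacobian in the change of variables formula is exactly the factor in
`volDensity_transition`. -/
theorem chartVolume_eq_of_subset (he : e ∈ atlas (EuclideanSpace ℝ (Fin n)) M)
    (he' : e' ∈ atlas (EuclideanSpace ℝ (Fin n)) M) {A : Set M} (hA : MeasurableSet A)
    (h1 : A ⊆ e.source) (h2 : A ⊆ e'.source) : chartVolume e A = chartVolume e' A := by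
  rw [chartVolume_apply e hA, chartVolume_apply e' hA]
  have himg : e'.target ∩ e'.symm ⁻¹' A = (e' ∘ e.symm) '' (e.target ∩ e.symm ⁻¹' A) := by
    ext w
    constructor
    · rintro ⟨hw, hwA⟩
      refine ⟨e (e'.symm w), ⟨e.map_source (h1 hwA), ?_⟩, ?_⟩
      · rw [mem_preimage, e.left_inv (h1 hwA)]
        exact hwA
      · simp [e.left_inv (h1 hwA), e'.right_inv hw]
    · rintro ⟨z, ⟨hz, hzA⟩, rfl⟩
      refine ⟨e'.map_source (h2 hzA), ?_⟩
      simp only [Function.comp, mem_preimage]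
      rw [e'.left_inv (h2 hzA)]
      exact hzA
  have hms : MeasurableSet (e.target ∩ e.symm ⁻¹' A) :=
    measurableSet_inter_preimage_of_continuousOn e.symm.continuousOn e.open_target.measurableSet hA
  rw [himg, lintegral_image_eq_lintegral_abs_det_fderiv_mul volume hms
    (f' := fun z => fderiv ℝ (e' ∘ e.symm) z)]
  · refine setLIntegral_congr_fun hms fun z hz => ?_
    simp only [Function.comp]
    rw [volDensity_transition he he' hz.1 (h2 hz.2), ENNReal.ofReal_mul (abs_nonneg _)]
  · intro z hz
    exact ((contDiffAt_transition he he' hz.1 (h2 hz.2)).differentiableAt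
      (by simp)).hasFDerivAt.hasFDerivWithinAt
  · intro z hz w hw hzw
    have := e'.injOn (h2 hz.2) (h2 hw.2) hzw
    exact e.symm.injOn hz.1 hw.1 this

variable [SecondCountableTopology M] [Nonempty M]

/-- The disjoint pieces partition `M`, and on each of them the two chart measures agree on the part
inside `e.source`. This removes the chosen cover from all later computations. -/
theorem riemannianVolume_restrict_source (he : e ∈ atlas (EuclideanSpace ℝ (Fin n)) M) :
    (riemannianVolume n M).restrict e.source = chartVolume e := by
  ext A hA
  rw [Measure.restrict_apply hA, ← chartVolume_apply_inter_source e hA]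
  have hms := hA.inter e.open_source.measurableSet
  set D := disjointed (fun j => (chartAt (EuclideanSpace ℝ (Fin n)) (chartCentre n M j)).source)
    with hD
  have hDm : ∀ k, MeasurableSet (D k) := fun k =>
    MeasurableSet.disjointed (fun j => (chartAt _ _).open_source.measurableSet) k
  have hDU : ⋃ k, D k = univ := by
    rw [hD, iUnion_disjointed]
    exact (exists_chart_cover n M).choose_spec
  have hDsub : ∀ k, D k ⊆ (chartAt (EuclideanSpace ℝ (Fin n)) (chartCentre n M k)).source :=
    fun k => disjointed_subset _ k
  rw [riemannianVolume, Measure.sum_apply _ hms]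
  have h1 : ∀ k, (chartVolume (chartAt (EuclideanSpace ℝ (Fin n)) (chartCentre n M k))).restrict
      (D k) (A ∩ e.source) = chartVolume e ((A ∩ e.source) ∩ D k) := by
    intro k
    rw [Measure.restrict_apply hms]
    exact chartVolume_eq_of_subset (chart_mem_atlas _ _) he (hms.inter (hDm k))
      (inter_subset_right.trans (hDsub k)) (inter_subset_left.trans inter_subset_right)
  refine (tsum_congr h1).trans ?_
  rw [← measure_iUnion _ fun k => hms.inter (hDm k), ← inter_iUnion, hDU, inter_univ]
  exact fun i j hij => ((disjoint_disjointed _) hij).mono inter_subset_right inter_subset_right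

theorem ae_of_ae_chart (he : e ∈ atlas (EuclideanSpace ℝ (Fin n)) M) {Ω : Set M}
    (hΩ : MeasurableSet Ω) {P : Coord n → Prop}
    (hP : ∀ᵐ z ∂(volume.restrict (e.target ∩ e.symm ⁻¹' Ω)), P z) :
    ∀ᵐ x ∂((riemannianVolume n M).restrict (e.source ∩ Ω)), P (e x) := by
  obtain ⟨N, hN, hNm, hN0⟩ := exists_measurable_superset_of_null hP
  rw [inter_comm, ← Measure.restrict_restrict hΩ, riemannianVolume_restrict_source he]
  have hBm : MeasurableSet (e.source ∩ e ⁻¹' N) :=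
    measurableSet_inter_preimage_of_continuousOn e.continuousOn e.open_source.measurableSet hNm
  have hB : (chartVolume e).restrict Ω (e.source ∩ e ⁻¹' N) = 0 := by
    rw [Measure.restrict_apply hBm, chartVolume_apply e (hBm.inter hΩ)]
    refine setLIntegral_measure_zero _ _ (measure_mono_null
      (t := N ∩ (e.target ∩ e.symm ⁻¹' Ω)) ?_ ?_)
    · rintro z ⟨hz, ⟨hz1, hz2⟩, hz3⟩
      refine ⟨?_, hz, hz3⟩
      have := hz2
      rwa [mem_preimage, e.right_inv hz] at this
    · rwa [Measure.restrict_apply hNm] at hN0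
  have hsrc : ∀ᵐ x ∂((chartVolume e).restrict Ω), x ∈ e.source := by
    rw [← riemannianVolume_restrict_source he, Measure.restrict_restrict hΩ, inter_comm,
      ← Measure.restrict_restrict e.open_source.measurableSet]
    exact ae_restrict_mem e.open_source.measurableSet
  have h0 := measure_eq_zero_iff_ae_notMem.1 hB
  filter_upwards [hsrc, h0] with x hx hx'
  by_contra h
  exact hx' ⟨hx, hN h⟩

/-- Countably many charts cover `M`, and chart-null sets are null for the volume. This is how
measurability of components, as in `AEMeasurableField`, becomes measurability on `Ω`. -/
theorem aemeasurable_of_chart {Ω : Set M} (hΩ : MeasurableSet Ω) {h : M → ℝ}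
    (hh : ∀ c : M, AEMeasurable (h ∘ (chartAt (EuclideanSpace ℝ (Fin n)) c).symm)
      (volume.restrict ((chartAt (EuclideanSpace ℝ (Fin n)) c).target ∩
      (chartAt (EuclideanSpace ℝ (Fin n)) c).symm ⁻¹' Ω))) :
    AEMeasurable h ((riemannianVolume n M).restrict Ω) := by
  have hU : Ω = ⋃ k, (chartAt (EuclideanSpace ℝ (Fin n)) (chartCentre n M k)).source ∩ Ω := by
    rw [← iUnion_inter, show ⋃ k, (chartAt (EuclideanSpace ℝ (Fin n)) (chartCentre n M k)).source =
      univ from (exists_chart_cover n M).choose_spec, univ_inter]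
  rw [hU, aemeasurable_iUnion_iff]
  intro k
  set e := chartAt (EuclideanSpace ℝ (Fin n)) (chartCentre n M k)
  have hg := hh (chartCentre n M k)
  have h1 := ae_of_ae_chart (e := e) (chart_mem_atlas _ _) hΩ hg.ae_eq_mk
  have h2 : AEMeasurable e ((riemannianVolume n M).restrict (e.source ∩ Ω)) :=
    (e.continuousOn.aemeasurable e.open_source.measurableSet).mono_measure
      (Measure.restrict_mono inter_subset_left le_rfl)
  refine (hg.measurable_mk.comp_aemeasurable h2).congr ?_
  filter_upwards [h1, ae_restrict_mem (e.open_source.measurableSet.inter hΩ)] with x hx hx'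
  simp only [Function.comp] at hx ⊢
  rw [← hx, e.left_inv hx'.1]

variable [IsContMDiffRiemannianBundle (𝓡 n) ∞ (EuclideanSpace ℝ (Fin n))
      (fun x : M => TangentSpace (𝓡 n) x)]

/-- The continuous density is bounded on a compact coordinate neighbourhood. This makes continuous
functions with compact support integrable. -/
instance isLocallyFiniteMeasure_riemannianVolume :
    IsLocallyFiniteMeasure (riemannianVolume n M) := by
  refine ⟨fun x => ?_⟩
  set e := chartAt (EuclideanSpace ℝ (Fin n)) x
  have he : e ∈ atlas (EuclideanSpace ℝ (Fin n)) M := chart_mem_atlas _ _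
  have hx : x ∈ e.source := mem_chart_source _ _
  obtain ⟨K, hKc, hKx, hK⟩ : ∃ K : Set (Coord n), IsCompact K ∧ K ∈ 𝓝 (e x) ∧ K ⊆ e.target := by
    obtain ⟨K, h1, h2, h3⟩ := local_compact_nhds (e.open_target.mem_nhds (e.map_source hx))
    exact ⟨K, h3, h1, h2⟩
  refine ⟨e.source ∩ e ⁻¹' (interior K), ?_, ?_⟩
  · exact (e.isOpen_inter_preimage isOpen_interior).mem_nhds ⟨hx, mem_interior_iff_mem_nhds.2 hKx⟩
  · have hm : MeasurableSet (e.source ∩ e ⁻¹' (interior K)) :=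
      (e.isOpen_inter_preimage isOpen_interior).measurableSet
    have h1 : riemannianVolume n M (e.source ∩ e ⁻¹' (interior K)) =
        chartVolume e (e.source ∩ e ⁻¹' (interior K)) := by
      rw [← riemannianVolume_restrict_source he, Measure.restrict_apply hm]
      congr 1
      ext y
      simp only [mem_inter_iff]
      tauto
    rw [h1, chartVolume_apply e hm]
    obtain ⟨C, hC⟩ := hKc.bddAbove_image ((continuousOn_volDensity he).mono hK)
    have hsub : e.target ∩ e.symm ⁻¹' (e.source ∩ e ⁻¹' (interior K)) ⊆ K := by
      rintro z ⟨hz, -, hz2⟩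
      have := hz2
      rw [mem_preimage, e.right_inv hz] at this
      exact interior_subset this
    calc ∫⁻ z in e.target ∩ e.symm ⁻¹' (e.source ∩ e ⁻¹' (interior K)),
          ENNReal.ofReal (volDensity e z)
        ≤ ∫⁻ z in K, ENNReal.ofReal (volDensity e z) := lintegral_mono_set hsub
      _ ≤ ∫⁻ z in K, ENNReal.ofReal C := setLIntegral_mono' hKc.measurableSet fun z hz =>
          ENNReal.ofReal_le_ofReal (hC (mem_image_of_mem _ hz))
      _ < ⊤ := by
          rw [setLIntegral_const]
          exact ENNReal.mul_lt_top ENNReal.ofReal_lt_top hKc.measure_lt_top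

theorem integral_eq_integral_chart (he : e ∈ atlas (EuclideanSpace ℝ (Fin n)) M) {h : M → ℝ}
    (hh : AEStronglyMeasurable h (riemannianVolume n M)) (hs : ∀ x ∉ e.source, h x = 0) :
    ∫ x, h x ∂(riemannianVolume n M) = ∫ z in e.target, volDensity e z * h (e.symm z) := by
  rw [← setIntegral_eq_integral_of_forall_compl_eq_zero hs, riemannianVolume_restrict_source he]
  have hh' : AEStronglyMeasurable h (chartVolume e) := by
    rw [← riemannianVolume_restrict_source he]
    exact hh.restrict
  rw [chartVolume] at hh' ⊢
  rw [integral_map (aemeasurable_chart_symm e) hh',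
    integral_withDensity_eq_integral_toReal_smul₀]
  · simp [volDensity, ENNReal.toReal_ofReal, Real.sqrt_nonneg]
  · exact ((continuousOn_volDensity he).aemeasurable e.open_target.measurableSet).ennreal_ofReal
  · exact Eventually.of_forall fun z => ENNReal.ofReal_lt_top

end Volume

/-! ### The gradient in charts: continuity and measurability -/

section Gradient

variable {n : ℕ} {M : Type*} [EMetricSpace M] [ChartedSpace (EuclideanSpace ℝ (Fin n)) M]
  [RiemannianBundle (fun x : M => TangentSpace (𝓡 n) x)]
  {e : OpenPartialHomeomorph M (EuclideanSpace ℝ (Fin n))}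

theorem inner_grad (f : M → ℝ) (x : M) (v : TangentSpace (𝓡 n) x) :
    inner ℝ v (grad f x) = dirDeriv f x v := by
  have : FiniteDimensional ℝ (TangentSpace (𝓡 n) x) :=
    inferInstanceAs (FiniteDimensional ℝ (EuclideanSpace ℝ (Fin n)))
  have : CompleteSpace (TangentSpace (𝓡 n) x) := FiniteDimensional.complete ℝ _
  rw [real_inner_comm]
  exact InnerProductSpace.toDual_symm_apply

theorem grad_eq_smul {f g : M → ℝ} {x : M} {c : ℝ}
    (h : ∀ v : Coord n, dirDeriv f x v = c * dirDeriv g x v) :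
    grad (n := n) f x = c • grad g x := by
  refine ext_inner_left ℝ fun v => ?_
  rw [inner_smul_right, inner_grad, inner_grad]
  exact h v

theorem grad_eq_zero_of_notMem_tsupport {f : M → ℝ} {x : M} (hx : x ∉ tsupport f) :
    grad (n := n) f x = 0 := by
  have h : f =ᶠ[𝓝 x] fun _ => 0 := notMem_tsupport_iff_eventuallyEq.1 hx
  refine ext_inner_left ℝ fun v => ?_
  rw [inner_grad, inner_zero_right]
  exact (dirDeriv_congr h v).trans (dirDeriv_const 0 x v)

variable [IsManifold (𝓡 n) ∞ M]

theorem norm_sq_eq_sum_gram (he : e ∈ atlas (EuclideanSpace ℝ (Fin n)) M)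
    (X : ∀ x : M, TangentSpace (𝓡 n) x) {z : Coord n} (hz : z ∈ e.target) :
    ‖X (e.symm z)‖ ^ 2 = ∑ i, ∑ j, chartField e X z i * chartField e X z j * gram e z i j := by
  rw [← metric_chartDsymm, chartDsymm_chartField he X hz, metric_self]

/-- Pairing `∇f` with the coordinate fields gives `G · (∇f) = ∂f`, and `G` is invertible. The
explicit formula is what yields continuity below. -/
theorem chartField_grad (he : e ∈ atlas (EuclideanSpace ℝ (Fin n)) M) {f : M → ℝ}
    {z : Coord n} (hz : z ∈ e.target) (hf : MDifferentiableAt (𝓡 n) 𝓘(ℝ, ℝ) f (e.symm z)) :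
    (chartField e (grad f) z).ofLp =
      (gram e z)⁻¹.mulVec fun j => fderiv ℝ (f ∘ e.symm) z (EuclideanSpace.single j 1) := by
  have h : (gram e z).mulVec (chartField e (grad f) z).ofLp =
      fun j => fderiv ℝ (f ∘ e.symm) z (EuclideanSpace.single j 1) := by
    funext j
    rw [← dirDeriv_chartDsymm he hz hf]
    have h1 := inner_grad f (e.symm z) (chartDsymm e z (EuclideanSpace.single j 1))
    have h2 := metric_chartDsymm e z (EuclideanSpace.single j 1) (chartField e (grad f) z)
    rw [chartDsymm_chartField he _ hz] at h2
    refine Eq.trans ?_ (h2.symm.trans h1)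
    simp [Matrix.mulVec, dotProduct, mul_comm]
  rw [← h, Matrix.mulVec_mulVec, Matrix.nonsing_inv_mul _ (gram_posDef he hz).det_pos.ne'.isUnit,
    Matrix.one_mulVec]

variable [IsContMDiffRiemannianBundle (𝓡 n) ∞ (EuclideanSpace ℝ (Fin n))
      (fun x : M => TangentSpace (𝓡 n) x)]

theorem continuousOn_chartField_grad (he : e ∈ atlas (EuclideanSpace ℝ (Fin n)) M) {f : M → ℝ}
    (hf : ContMDiff (𝓡 n) 𝓘(ℝ, ℝ) ∞ f) :
    ContinuousOn (chartField e (grad (n := n) f)) e.target := by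
  have hd := (contDiffOn_comp_chart_symm he hf).continuousOn_fderiv_of_isOpen e.open_target
    (by simp)
  have h : ContinuousOn (fun z => WithLp.toLp 2 ((gram e z)⁻¹.mulVec fun j =>
      fderiv ℝ (f ∘ e.symm) z (EuclideanSpace.single j 1))) e.target := by
    refine (PiLp.continuous_toLp 2 _).comp_continuousOn ?_
    have hg : ContinuousOn (gram e) e.target :=
      continuousOn_pi (f := fun z => (gram e z : Fin n → Fin n → ℝ)).2 fun i =>
        continuousOn_pi.2 fun j => continuousOn_gram he i j
    have hdet : ContinuousOn (fun z : Coord n => (gram e z).det) e.target :=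
      (Continuous.matrix_det (A := fun A : Matrix (Fin n) (Fin n) ℝ => A)
        continuous_id).comp_continuousOn hg
    have hadj : ContinuousOn (fun z : Coord n => (gram e z).adjugate) e.target :=
      (Continuous.matrix_adjugate (A := fun A : Matrix (Fin n) (Fin n) ℝ => A)
        continuous_id).comp_continuousOn hg
    have hginv : ContinuousOn (fun z : Coord n => (gram e z)⁻¹) e.target := by
      simp only [Matrix.inv_def, Ring.inverse_eq_inv']
      exact (hdet.inv₀ fun z hz => (gram_posDef he hz).det_pos.ne').smul hadj
    have h2 : ContinuousOn (fun z => fun j : Fin n =>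
        fderiv ℝ (f ∘ e.symm) z (EuclideanSpace.single j 1)) e.target :=
      continuousOn_pi.2 fun j => hd.clm_apply continuousOn_const
    exact (Continuous.matrix_mulVec
      (A := fun q : Matrix (Fin n) (Fin n) ℝ × (Fin n → ℝ) => q.1) continuous_fst continuous_snd).comp_continuousOn
      (hginv.prodMk h2)
  refine h.congr fun z hz => ?_
  beta_reduce
  rw [← chartField_grad he hz (hf.mdifferentiable (by simp) _)]

/-- The norm changes with the fibre, so continuity is read off the quadratic form of the Gram
matrix. -/
theorem continuous_norm_grad {f : M → ℝ} (hf : ContMDiff (𝓡 n) 𝓘(ℝ, ℝ) ∞ f) :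
    Continuous fun x => ‖grad (n := n) f x‖ := by
  rw [continuous_iff_continuousAt]
  intro x
  set e := chartAt (EuclideanSpace ℝ (Fin n)) x
  have he : e ∈ atlas (EuclideanSpace ℝ (Fin n)) M := chart_mem_atlas _ _
  have hx : x ∈ e.source := mem_chart_source _ _
  have hc := continuousOn_chartField_grad he hf
  have hci : ∀ i, ContinuousOn (fun z => chartField e (grad (n := n) f) z i) e.target := fun i =>
    (EuclideanSpace.proj i : Coord n →L[ℝ] ℝ).continuous.comp_continuousOn hc
  have h1 : ContinuousOn (fun z => √(∑ i, ∑ j, chartField e (grad (n := n) f) z i *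
      chartField e (grad (n := n) f) z j * gram e z i j)) e.target :=
    Real.continuous_sqrt.comp_continuousOn <| continuousOn_finsetSum _ fun i _ =>
      continuousOn_finsetSum _ fun j _ => ((hci i).mul (hci j)).mul (continuousOn_gram he i j)
  have h2 := (h1.comp e.continuousOn e.mapsTo).continuousAt (e.open_source.mem_nhds hx)
  refine h2.congr ?_
  filter_upwards [e.open_source.mem_nhds hx] with y hy
  simp only [Function.comp]
  rw [← norm_sq_eq_sum_gram he _ (e.map_source hy), Real.sqrt_sq (norm_nonneg _), e.left_inv hy]

theorem aemeasurable_norm_of_aemeasurableField [MeasurableSpace M] [BorelSpace M]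
    [SecondCountableTopology M] [Nonempty M] {Ω : Set M} (hΩ : MeasurableSet Ω)
    {X : ∀ x : M, TangentSpace (𝓡 n) x} (hX : AEMeasurableField Ω X) :
    AEMeasurable (fun x => ‖X x‖) ((riemannianVolume n M).restrict Ω) := by
  refine aemeasurable_of_chart hΩ fun c => ?_
  have hXc := hX c
  set e := chartAt (EuclideanSpace ℝ (Fin n)) c
  have he : e ∈ atlas (EuclideanSpace ℝ (Fin n)) M := chart_mem_atlas _ _
  have hm : MeasurableSet (e.target ∩ e.symm ⁻¹' Ω) :=
    measurableSet_inter_preimage_of_continuousOn e.symm.continuousOn e.open_target.measurableSet hΩ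
  have hXi : ∀ i, AEMeasurable (fun z => chartField e X z i)
      (volume.restrict (e.target ∩ e.symm ⁻¹' Ω)) := fun i =>
    (EuclideanSpace.proj i : Coord n →L[ℝ] ℝ).continuous.measurable.comp_aemeasurable hXc
  have hg : ∀ i j, AEMeasurable (fun z => gram e z i j)
      (volume.restrict (e.target ∩ e.symm ⁻¹' Ω)) := fun i j =>
    ((continuousOn_gram he i j).mono inter_subset_left).aemeasurable hm
  have h1 : AEMeasurable (fun z => √(∑ i, ∑ j, chartField e X z i *
      chartField e X z j * gram e z i j)) (volume.restrict (e.target ∩ e.symm ⁻¹' Ω)) :=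
    (Finset.aemeasurable_fun_sum _ fun i _ => Finset.aemeasurable_fun_sum _ fun j _ =>
      ((hXi i).mul (hXi j)).mul (hg i j)).sqrt
  refine h1.congr ?_
  filter_upwards [ae_restrict_mem hm] with z hz
  rw [← norm_sq_eq_sum_gram he _ hz.1, Real.sqrt_sq (norm_nonneg _)]
  rfl

theorem aemeasurableField_grad [MeasurableSpace M] [BorelSpace M] {Ω : Set M}
    (hΩ : MeasurableSet Ω) {f : M → ℝ} (hf : ContMDiff (𝓡 n) 𝓘(ℝ, ℝ) ∞ f) :
    AEMeasurableField Ω (grad (n := n) f) := fun c =>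
  ((continuousOn_chartField_grad (chart_mem_atlas _ c) hf).mono inter_subset_left).aemeasurable
    (measurableSet_inter_preimage_of_continuousOn (chartAt _ c).symm.continuousOn
      (chartAt _ c).open_target.measurableSet hΩ)

end Gradient

/-! ### From the pointwise to the weak divergence inequality -/

section Divergence

variable {n : ℕ} {M : Type*} [EMetricSpace M] [ChartedSpace (EuclideanSpace ℝ (Fin n)) M]
  [RiemannianBundle (fun x : M => TangentSpace (𝓡 n) x)]
  {e e' : OpenPartialHomeomorph M (EuclideanSpace ℝ (Fin n))}
  {X : ∀ x : M, TangentSpace (𝓡 n) x}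

theorem divergence_eq_clmTrace (X : ∀ x : M, TangentSpace (𝓡 n) x) (x : M) :
    divergence X x =
      clmTrace (fderiv ℝ (fun z => volDensity (chartAt (EuclideanSpace ℝ (Fin n)) x) z •
        chartField (chartAt (EuclideanSpace ℝ (Fin n)) x) X z)
          (chartAt (EuclideanSpace ℝ (Fin n)) x x)) /
      volDensity (chartAt (EuclideanSpace ℝ (Fin n)) x) (chartAt (EuclideanSpace ℝ (Fin n)) x x) := by
  rw [clmTrace_eq_sum]
  rfl

variable [IsManifold (𝓡 n) ∞ M]

/-- The divergence does not depend on the chart, as an inequality: a positive lower bound for the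
divergence forces differentiability in the preferred chart, hence in every chart. -/
theorem exists_hasFDerivAt_of_le_divergence (he : e ∈ atlas (EuclideanSpace ℝ (Fin n)) M)
    {z : Coord n} (hz : z ∈ e.target) {b : ℝ} (hb : 0 < b) (hdiv : b ≤ divergence X (e.symm z)) :
    ∃ V' : Coord n →L[ℝ] Coord n,
      HasFDerivAt (fun y => volDensity e y • chartField e X y) V' z ∧
      b * volDensity e z ≤ clmTrace V' := by
  set x := e.symm z with hxdef
  set e' := chartAt (EuclideanSpace ℝ (Fin n)) x with he'def
  have he' : e' ∈ atlas (EuclideanSpace ℝ (Fin n)) M := chart_mem_atlas _ _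
  have hx : x ∈ e'.source := mem_chart_source _ _
  rw [divergence_eq_clmTrace] at hdiv
  set V₀ : Coord n → Coord n := fun z => volDensity e' z • chartField e' X z with hV₀
  have hvol : 0 < volDensity e' (e' x) := volDensity_pos he' (e'.map_source hx)
  have htr : b * volDensity e' (e' x) ≤ clmTrace (fderiv ℝ V₀ (e' x)) := (le_div_iff₀ hvol).1 hdiv
  -- Without differentiability `fderiv` is `0` by default, and the trace could not reach the
  -- positive bound.
  have hdiff : DifferentiableAt ℝ V₀ (e' x) := by
    by_contra h
    rw [fderiv_zero_of_not_differentiableAt h] at htr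
    have : clmTrace (0 : Coord n →L[ℝ] Coord n) = 0 := by simp [clmTrace]
    rw [this] at htr
    exact absurd htr (not_le.2 (mul_pos hb hvol))
  set A : Coord n → Coord n →L[ℝ] Coord n := fderiv ℝ (e' ∘ e.symm) with hA
  have hτ : ContDiffAt ℝ ∞ (e' ∘ e.symm) z := contDiffAt_transition he he' hz hx
  have hAd : DifferentiableAt ℝ A z :=
    (hτ.fderiv_right (m := 1) (by norm_cast)).differentiableAt (by simp)
  have hsymm : IsSymmSndFDerivAt ℝ (e' ∘ e.symm) z :=
    hτ.isSymmSndFDerivAt (by rw [minSmoothness_of_isRCLikeNormedField]; exact ENat.LEInfty.out)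
  obtain ⟨W', hW', htrW⟩ := exists_hasFDerivAt_piola hAd.hasFDerivAt (fun h k => hsymm h k)
    (hτ.differentiableAt (by simp)).hasFDerivAt hdiff.hasFDerivAt
    (isUnit_fderiv_transition he he' hz hx)
  have hdet0 : (A z).det ≠ 0 := by
    obtain ⟨u, hu⟩ := isUnit_fderiv_transition he he' hz hx
    have h1 : (u : Coord n →L[ℝ] Coord n).det * (↑u⁻¹ : Coord n →L[ℝ] Coord n).det = 1 := by
      rw [ContinuousLinearMap.det, ContinuousLinearMap.det, ← LinearMap.det_comp]
      exact (congrArg ContinuousLinearMap.det u.mul_inv).trans LinearMap.det_id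
    rw [hA, ← hu]
    exact left_ne_zero_of_mul_eq_one h1
  -- The density transforms by `|det|`, Piola's identity by `det`; they differ by the sign `s`,
  -- which is constant near `z`.
  obtain ⟨s, hs⟩ : ∃ s : ℝ, ∀ᶠ y in 𝓝 z, |(A y).det| = s * (A y).det := by
    have hc : ContinuousAt (fun y => (A y).det) z :=
      (differentiable_clm_det (E := Coord n)).continuous.continuousAt.comp hAd.continuousAt
    rcases hdet0.lt_or_gt with h | h
    · refine ⟨-1, ?_⟩
      filter_upwards [hc.eventually (gt_mem_nhds h)] with y hy
      rw [abs_of_neg hy]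
      ring
    · refine ⟨1, ?_⟩
      filter_upwards [hc.eventually (lt_mem_nhds h)] with y hy
      rw [abs_of_pos hy, one_mul]
  refine ⟨s • W', (hW'.const_smul s).congr_of_eventuallyEq ?_, ?_⟩
  · have hnhds : (e.symm.trans e').source ∈ 𝓝 z := (e.symm.trans e').open_source.mem_nhds
      (by simp only [mfld_simps]; exact ⟨hz, hx⟩)
    filter_upwards [hs, hnhds] with y hy hy'
    simp only [mfld_simps] at hy'
    rw [volDensity_transition he he' hy'.1 hy'.2, chartField_transition he he' X hy'.1 hy'.2]
    simp only [Pi.smul_apply, hV₀, Function.comp, map_smul]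
    rw [hy, smul_smul, smul_smul]
  · rw [clmTrace_smul, htrW, volDensity_transition he he' hz hx, ← mul_assoc s, ← hs.self_of_nhds,
      mul_left_comm]
    exact mul_le_mul_of_nonneg_left htr (abs_nonneg _)

variable [IsContMDiffRiemannianBundle (𝓡 n) ∞ (EuclideanSpace ℝ (Fin n))
      (fun x : M => TangentSpace (𝓡 n) x)]
  [MeasurableSpace M] [BorelSpace M] [SecondCountableTopology M] [Nonempty M]

/-- With `ζ` the function `η` in coordinates and `V = √(det g) X`, the trace of `D(ζV)` is `ζ tr(DV)
+ dζ(V)`, at least `q = b √(det g) ζ + dζ(V)`. Unlike `tr(DV)`, this `q` is continuous, because `V`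
is differentiable and so continuous; hence `∫ q ≤ 0`, which is the claim. -/
theorem weak_divergence_of_tsupport_subset_source
    (he : e ∈ atlas (EuclideanSpace ℝ (Fin n)) M) {Ω : Set M} (hΩ : IsOpen Ω) {b : ℝ} (hb : 0 < b)
    (hdiv : ∀ x ∈ Ω, b ≤ divergence X x) {η : M → ℝ} (hη : IsTestFunction n Ω η)
    (hη0 : ∀ x, 0 ≤ η x) (hηe : tsupport η ⊆ e.source) :
    Continuous (fun x => dirDeriv η x (X x)) ∧
      b * ∫ x, η x ∂(riemannianVolume n M) ≤
        -∫ x, dirDeriv η x (X x) ∂(riemannianVolume n M) := by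
  set V : Coord n → Coord n := fun y => volDensity e y • chartField e X y with hV
  set U := e.target ∩ e.symm ⁻¹' Ω with hU
  have hUo : IsOpen U := e.isOpen_inter_preimage_symm hΩ
  set K := e '' tsupport η with hK
  have hKc : IsCompact K := hη.compact.isCompact.image_of_continuousOn (e.continuousOn.mono hηe)
  have hKU : K ⊆ U := by
    rintro _ ⟨x, hx, rfl⟩
    refine ⟨e.map_source (hηe hx), ?_⟩
    rw [mem_preimage, e.left_inv (hηe hx)]
    exact hη.support hx
  have hKo : IsOpen Kᶜ := hKc.isClosed.isOpen_compl
  choose! V' hV' htr using fun (z : Coord n) (hz : z ∈ U) =>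
    exists_hasFDerivAt_of_le_divergence he hz.1 hb (hdiv _ hz.2)
  set ζ : Coord n → ℝ := e.target.indicator (η ∘ e.symm) with hζ
  have hζK : ∀ z ∈ Kᶜ, ζ z = 0 := by
    intro z hz
    rw [hζ, indicator_apply_eq_zero]
    intro hzt
    by_contra h
    exact hz ⟨e.symm z, subset_tsupport _ h, e.right_inv hzt⟩
  have hζK' : ∀ z ∈ Kᶜ, ζ =ᶠ[𝓝 z] fun _ => 0 := fun z hz => by
    filter_upwards [hKo.mem_nhds hz] with y hy using hζK y hy
  have hζU : ContDiffOn ℝ ∞ ζ U := by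
    refine ((contDiffOn_comp_chart_symm he hη.smooth).mono inter_subset_left).congr fun z hz => ?_
    rw [hζ, indicator_of_mem hz.1]
  have hcov : ∀ z, z ∈ U ∨ z ∈ Kᶜ := fun z => by
    by_cases h : z ∈ K
    · exact Or.inl (hKU h)
    · exact Or.inr h
  have hVc : ContinuousOn V U := fun z hz => (hV' z hz).continuousAt.continuousWithinAt
  have hζ'K : ∀ z ∈ Kᶜ, fderiv ℝ ζ z = 0 := fun z hz => by
    rw [(hζK' z hz).fderiv_eq, fderiv_fun_const]
    rfl
  have hcont : ∀ {g : Coord n → ℝ}, ContinuousOn g U → (∀ z ∈ Kᶜ, g z = 0) → Continuous g := by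
    intro g hg hgK
    rw [continuous_iff_continuousAt]
    intro z
    rcases hcov z with h | h
    · exact hg.continuousAt (hUo.mem_nhds h)
    · refine (continuousAt_const (y := (0 : ℝ))).congr ?_
      filter_upwards [hKo.mem_nhds h] with y hy using (hgK y hy).symm
  set g : Coord n → ℝ := fun z => fderiv ℝ ζ z (V z) with hg
  have hgK : ∀ z ∈ Kᶜ, g z = 0 := fun z hz => by simp [hg, hζ'K z hz]
  have hgc : Continuous g :=
    hcont ((hζU.continuousOn_fderiv_of_isOpen hUo (by simp)).clm_apply hVc) hgK
  set q : Coord n → ℝ := fun z => b * (volDensity e z * ζ z) + g z with hq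
  have hqK : ∀ z ∈ Kᶜ, q z = 0 := fun z hz => by simp [hq, hgK z hz, hζK z hz]
  have hqc : Continuous q := by
    refine hcont ?_ hqK
    exact (continuousOn_const.mul (((continuousOn_volDensity he).mono inter_subset_left).mul
      hζU.continuousOn)).add hgc.continuousOn
  have hFU : ∀ z ∈ U, HasFDerivAt (fun z => ζ z • V z)
      (ζ z • V' z + (fderiv ℝ ζ z).smulRight (V z)) z := fun z hz =>
    (((hζU.differentiableOn (by simp)).differentiableAt (hUo.mem_nhds hz)).hasFDerivAt).smul
      (hV' z hz)
  have hFK : ∀ z ∈ Kᶜ, HasFDerivAt (fun z => ζ z • V z) (0 : Coord n →L[ℝ] Coord n) z := by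
    intro z hz
    refine (hasFDerivAt_const (0 : Coord n) z).congr_of_eventuallyEq ?_
    filter_upwards [hζK' z hz] with y hy
    rw [hy, zero_smul]
  have hint : ∫ z, q z ≤ 0 := by
    refine integral_nonpos_of_le_clmTrace_fderiv (F := fun z => ζ z • V z) ?_ ?_ hqc ?_ ?_
    · intro z
      rcases hcov z with h | h
      · exact (hFU z h).differentiableAt
      · exact (hFK z h).differentiableAt
    · exact HasCompactSupport.intro hKc fun z hz => by simp [hζK z hz]
    · exact HasCompactSupport.intro hKc hqK
    · intro z
      by_cases h : z ∈ K
      · have hzU := hKU h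
        rw [(hFU z hzU).fderiv, clmTrace_add, clmTrace_smul, clmTrace_smulRight]
        have h0 : 0 ≤ ζ z := indicator_nonneg (fun _ _ => hη0 _) z
        have := mul_le_mul_of_nonneg_left (htr z hzU) h0
        simp only [hq, hg]
        linarith
      · rw [(hFK z h).fderiv, hqK z h]
        simp [clmTrace]
  have hgη : ∀ z ∈ e.target, g z = volDensity e z * dirDeriv η (e.symm z) (X (e.symm z)) := by
    intro z hz
    have h1 : ζ =ᶠ[𝓝 z] η ∘ e.symm := by
      filter_upwards [e.open_target.mem_nhds hz] with y hy
      rw [hζ, indicator_of_mem hy]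
    have h2 : dirDeriv η (e.symm z) (X (e.symm z)) =
        fderiv ℝ (η ∘ e.symm) z (chartField e X z) :=
      (congrArg (dirDeriv η (e.symm z)) (chartDsymm_chartField he X hz).symm).trans
        (dirDeriv_chartDsymm he hz (hη.smooth.mdifferentiable (by simp) _) _)
    rw [h2, hg, ← h1.fderiv_eq]
    simp [hV]
  have hzero : ∀ x ∉ tsupport η, dirDeriv η x (X x) = 0 := fun x hx =>
    (dirDeriv_congr (notMem_tsupport_iff_eventuallyEq.1 hx) _).trans (dirDeriv_const 0 x _)
  have hcontM : Continuous (fun x => dirDeriv η x (X x)) := by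
    rw [continuous_iff_continuousAt]
    intro x
    by_cases hx : x ∈ tsupport η
    · have h1 : ContinuousOn (fun x => g (e x) / volDensity e (e x)) e.source :=
        (hgc.comp_continuousOn e.continuousOn).div
          ((continuousOn_volDensity he).comp e.continuousOn e.mapsTo)
          fun y hy => (volDensity_pos he (e.map_source hy)).ne'
      refine (h1.continuousAt (e.open_source.mem_nhds (hηe hx))).congr ?_
      filter_upwards [e.open_source.mem_nhds (hηe hx)] with y hy
      have h2 := hgη (e y) (e.map_source hy)
      have h3 : ∀ w, w = y → dirDeriv η w (X w) = dirDeriv η y (X y) := by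
        rintro w rfl
        rfl
      rw [h2, h3 _ (e.left_inv hy)]
      exact mul_div_cancel_left₀ _ (volDensity_pos he (e.map_source hy)).ne'
    · refine (continuousAt_const (y := (0 : ℝ))).congr ?_
      filter_upwards [(isClosed_tsupport η).isOpen_compl.mem_nhds hx] with y hy
        using (hzero y hy).symm
  refine ⟨hcontM, ?_⟩
  have hcs : HasCompactSupport (fun x => dirDeriv η x (X x)) :=
    HasCompactSupport.intro hη.compact.isCompact hzero
  have hηi : Integrable η (riemannianVolume n M) :=
    hη.smooth.continuous.integrable_of_hasCompactSupport hη.compact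
  have hdi : Integrable (fun x => dirDeriv η x (X x)) (riemannianVolume n M) :=
    hcontM.integrable_of_hasCompactSupport hcs
  have hsum : ∫ x, (b * η x + dirDeriv η x (X x)) ∂(riemannianVolume n M) = ∫ z, q z := by
    rw [integral_eq_integral_chart he (h := fun x => b * η x + dirDeriv η x (X x))
      ((hηi.const_mul b).add hdi).aestronglyMeasurable]
    · rw [← setIntegral_eq_integral_of_forall_compl_eq_zero (s := e.target) (f := q)
        fun z hz => hqK z fun h => hz (hKU h).1]
      refine setIntegral_congr_fun e.open_target.measurableSet fun z hz => ?_
      simp only [hq, hgη z hz, hζ, indicator_of_mem hz, Function.comp]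
      ring
    · intro x hx
      have hx' : x ∉ tsupport η := fun h => hx (hηe h)
      rw [hzero x hx', image_eq_zero_of_notMem_tsupport hx']
      ring
  rw [integral_add (hηi.const_mul b) hdi, integral_const_mul] at hsum
  linarith

/-- A partition of unity subordinate to charts makes `η` a finite sum of nonnegative `ρ i * η`, each
covered by the local lemma. The induction also carries continuity of the directional derivative,
which gives the integrability needed to add integrals. -/
theorem weak_divergence_of_le_divergence {Ω : Set M} (hΩ : IsOpen Ω) {b : ℝ} (hb : 0 < b)
    (hdiv : ∀ x ∈ Ω, b ≤ divergence X x) {η : M → ℝ} (hη : IsTestFunction n Ω η)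
    (hη0 : ∀ x, 0 ≤ η x) :
    b * ∫ x, η x ∂(riemannianVolume n M) ≤
      -∫ x, dirDeriv η x (X x) ∂(riemannianVolume n M) := by
  have : LocallyCompactSpace M := ChartedSpace.locallyCompactSpace (EuclideanSpace ℝ (Fin n)) M
  obtain ⟨ρ, hρ⟩ := SmoothPartitionOfUnity.exists_isSubordinate_chartAt_source (𝓡 n) M
  have hfin := ρ.locallyFinite.finite_nonempty_inter_compact hη.compact.isCompact
  have htest : ∀ i, IsTestFunction n Ω (fun x => ρ i x * η x) := fun i =>
    ⟨(ρ i).contMDiff.mul hη.smooth, hη.compact.mul_left,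
      (tsupport_mul_subset_right (f := ρ i) (g := η)).trans hη.support⟩
  have hloc := fun i => weak_divergence_of_tsupport_subset_source
    (chart_mem_atlas (EuclideanSpace ℝ (Fin n)) i) hΩ hb hdiv (htest i)
    (fun x => mul_nonneg (ρ.nonneg i x) (hη0 x))
    ((tsupport_mul_subset_left (f := ρ i) (g := η)).trans (hρ i))
  have hint : ∀ {ψ : M → ℝ}, IsTestFunction n Ω ψ → Continuous (fun x => dirDeriv ψ x (X x)) →
      Integrable (fun x => dirDeriv ψ x (X x)) (riemannianVolume n M) := fun hψ hc =>
    hc.integrable_of_hasCompactSupport <| HasCompactSupport.intro hψ.compact.isCompact fun x hx =>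
      (dirDeriv_congr (notMem_tsupport_iff_eventuallyEq.1 hx) _).trans (dirDeriv_const 0 x _)
  have hsum : ∀ t : Finset M, IsTestFunction n Ω (fun x => ∑ i ∈ t, ρ i x * η x) ∧
      Continuous (fun x => dirDeriv (fun y => ∑ i ∈ t, ρ i y * η y) x (X x)) ∧
      b * ∫ x, ∑ i ∈ t, ρ i x * η x ∂(riemannianVolume n M) ≤
        -∫ x, dirDeriv (fun y => ∑ i ∈ t, ρ i y * η y) x (X x) ∂(riemannianVolume n M) := by
    classical
    intro t
    induction t using Finset.induction_on with
    | empty =>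
      have h0 : ∀ x, dirDeriv (fun _ : M => (0 : ℝ)) x (X x) = 0 := fun x =>
        dirDeriv_const 0 x _
      simp only [Finset.sum_empty]
      refine ⟨⟨contMDiff_const, HasCompactSupport.zero, ?_⟩, ?_, ?_⟩
      · simp [tsupport]
      · exact continuous_const.congr fun x => (h0 x).symm
      · rw [integral_congr_ae (Eventually.of_forall h0)]
        simp
    | insert i t hi ih =>
      obtain ⟨ih1, ih2, ih3⟩ := ih
      have hfun : (fun x => ∑ j ∈ insert i t, ρ j x * η x) =
          (fun x => ρ i x * η x) + fun x => ∑ j ∈ t, ρ j x * η x := by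
        funext x
        simp [Finset.sum_insert hi]
      have hd : ∀ x, dirDeriv ((fun x => ρ i x * η x) + fun x => ∑ j ∈ t, ρ j x * η x) x (X x) =
          dirDeriv (fun x => ρ i x * η x) x (X x) +
            dirDeriv (fun x => ∑ j ∈ t, ρ j x * η x) x (X x) := fun x =>
        dirDeriv_add ((htest i).smooth.mdifferentiable (by simp) x)
          (ih1.smooth.mdifferentiable (by simp) x) _
      have hfun' : ∀ x, ∑ j ∈ insert i t, ρ j x * η x =
          ρ i x * η x + ∑ j ∈ t, ρ j x * η x := fun x => Finset.sum_insert hi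
      rw [integral_congr_ae (Eventually.of_forall hfun'), hfun,
        integral_congr_ae (Eventually.of_forall hd), integral_add
          ((htest i).smooth.continuous.integrable_of_hasCompactSupport (htest i).compact)
          (ih1.smooth.continuous.integrable_of_hasCompactSupport ih1.compact),
        integral_add (hint (htest i) (hloc i).1) (hint ih1 ih2)]
      refine ⟨⟨(htest i).smooth.add ih1.smooth, (htest i).compact.add ih1.compact,
        (tsupport_add _ _).trans (union_subset (htest i).support ih1.support)⟩,
        ((hloc i).1.add ih2).congr fun x => (hd x).symm, ?_⟩
      have := (hloc i).2
      rw [mul_add]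
      linarith
  have hη_eq : (fun x => ∑ i ∈ hfin.toFinset, ρ i x * η x) = η := by
    funext x
    by_cases hx : x ∈ tsupport η
    · rw [← Finset.sum_mul]
      have h1 := ρ.sum_eq_one (mem_univ x)
      rw [finsum_eq_sum_of_support_subset (s := hfin.toFinset)] at h1
      · rw [h1, one_mul]
      · intro i hi
        rw [Set.Finite.coe_toFinset]
        exact ⟨x, hi, hx⟩
    · simp [image_eq_zero_of_notMem_tsupport hx]
  have := (hsum hfin.toFinset).2.2
  rwa [hη_eq] at this

theorem weakPLaplacianGE_of_le_pLaplacian {p : ℝ} {Ω : Set M} (hΩ : IsOpen Ω) {f : M → ℝ} {b : ℝ}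
    (hb : 0 < b) (hlap : ∀ x ∈ Ω, b ≤ pLaplacian n p f x) : WeakPLaplacianGE n p Ω f b := by
  intro φ hφ hφ0
  have h := weak_divergence_of_le_divergence hΩ hb hlap hφ hφ0
  rw [setIntegral_eq_integral_of_forall_compl_eq_zero, setIntegral_eq_integral_of_forall_compl_eq_zero]
  · refine h.trans_eq (congrArg Neg.neg (integral_congr_ae (Eventually.of_forall fun x => ?_)))
    exact (inner_grad φ x _).symm
  · intro x hx
    rw [grad_eq_zero_of_notMem_tsupport fun h => hx (hφ.support h), inner_zero_right]
  · exact fun x hx => image_eq_zero_of_notMem_tsupport fun h => hx (hφ.support h)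

end Divergence

/-! ### Smoothing of `|t|^p` -/

/-- A smooth approximation of `|t| ^ p` which vanishes at `0`. -/
noncomputable def smoothAbsRpow (p ε t : ℝ) : ℝ := (t ^ 2 + ε ^ 2) ^ (p / 2) - (ε ^ 2) ^ (p / 2)

section SmoothAbsRpow

variable {p ε : ℝ}

theorem contDiff_smoothAbsRpow (hε : 0 < ε) : ContDiff ℝ ∞ (smoothAbsRpow p ε) :=
  (((contDiff_id.pow 2).add contDiff_const).rpow_const_of_ne fun t => by
    simp only [id]; positivity).sub contDiff_const

theorem hasDerivAt_smoothAbsRpow (hε : 0 < ε) (t : ℝ) :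
    HasDerivAt (smoothAbsRpow p ε) (p * t * (t ^ 2 + ε ^ 2) ^ (p / 2 - 1)) t := by
  have h1 : HasDerivAt (fun t : ℝ => t ^ 2 + ε ^ 2) (2 * t) t := by
    simpa using (hasDerivAt_pow 2 t).add_const (ε ^ 2)
  have h2 := (h1.rpow_const (p := p / 2) (Or.inl (by positivity))).sub_const ((ε ^ 2) ^ (p / 2))
  exact h2.congr_deriv (by ring)

theorem smoothAbsRpow_zero : smoothAbsRpow p ε 0 = 0 := by simp [smoothAbsRpow]

theorem smoothAbsRpow_nonneg (hp : 0 ≤ p) (t : ℝ) : 0 ≤ smoothAbsRpow p ε t :=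
  sub_nonneg.2 (Real.rpow_le_rpow (sq_nonneg _) (by nlinarith [sq_nonneg t]) (by linarith))

/-- From `|t| ≤ (t² + ε²)^(1/2)`. For `p > 1` the new exponent is positive, so the bound behaves
well as `ε → 0`, whereas `p / 2 - 1` may be negative. -/
theorem abs_deriv_smoothAbsRpow_le (hp : 0 ≤ p) (hε : 0 < ε) (t : ℝ) :
    |p * t * (t ^ 2 + ε ^ 2) ^ (p / 2 - 1)| ≤ p * (t ^ 2 + ε ^ 2) ^ ((p - 1) / 2) := by
  have hpos : 0 < t ^ 2 + ε ^ 2 := by positivity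
  rw [abs_mul, abs_mul, abs_of_nonneg hp, abs_of_nonneg (Real.rpow_nonneg hpos.le _), mul_assoc]
  refine mul_le_mul_of_nonneg_left ?_ hp
  have h1 : |t| ≤ (t ^ 2 + ε ^ 2) ^ (1 / 2 : ℝ) := by
    rw [← Real.sqrt_eq_rpow]
    exact Real.abs_le_sqrt (by nlinarith [sq_nonneg ε])
  calc |t| * (t ^ 2 + ε ^ 2) ^ (p / 2 - 1)
      ≤ (t ^ 2 + ε ^ 2) ^ (1 / 2 : ℝ) * (t ^ 2 + ε ^ 2) ^ (p / 2 - 1) := by gcongr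
    _ = (t ^ 2 + ε ^ 2) ^ ((p - 1) / 2) := by
        rw [← Real.rpow_add hpos]
        congr 1
        ring

theorem sq_rpow_half (t q : ℝ) : (t ^ 2) ^ (q / 2) = |t| ^ q := by
  rw [← sq_abs, ← Real.rpow_natCast, ← Real.rpow_mul (abs_nonneg t)]
  congr 1
  push_cast
  ring

end SmoothAbsRpow

/-! ### The inequality for test functions -/

section Eigenvalue

variable {n : ℕ} {M : Type*} [EMetricSpace M] [ChartedSpace (EuclideanSpace ℝ (Fin n)) M]
  [RiemannianBundle (fun x : M => TangentSpace (𝓡 n) x)]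

theorem norm_pField_le {p a : ℝ} (hp : 1 < p) {f : M → ℝ} {x : M}
    (h : ‖grad (n := n) f x‖ ≤ a) : ‖pField (n := n) p f x‖ ≤ a ^ (p - 1) := by
  rw [pField, norm_smul, Real.norm_of_nonneg (Real.rpow_nonneg (norm_nonneg _) _)]
  -- The power `p - 2` may be negative, so exponents are added only where the gradient is nonzero.
  rcases (norm_nonneg (grad (n := n) f x)).eq_or_lt with h0 | h0
  · rw [← h0, mul_zero]
    exact Real.rpow_nonneg ((norm_nonneg _).trans h) _
  · rw [← Real.rpow_add_one h0.ne']
    calc ‖grad (n := n) f x‖ ^ (p - 2 + 1) = ‖grad (n := n) f x‖ ^ (p - 1) := by ring_nf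
      _ ≤ a ^ (p - 1) := Real.rpow_le_rpow (norm_nonneg _) h (by linarith)

theorem hasCompactSupport_norm_grad {Ω : Set M} {φ : M → ℝ} (hφ : IsTestFunction n Ω φ) :
    HasCompactSupport fun x => ‖grad (n := n) φ x‖ :=
  HasCompactSupport.intro hφ.compact.isCompact fun x hx => by
    rw [grad_eq_zero_of_notMem_tsupport hx, norm_zero]

variable [IsManifold (𝓡 n) ∞ M]
  [IsContMDiffRiemannianBundle (𝓡 n) ∞ (EuclideanSpace ℝ (Fin n))
      (fun x : M => TangentSpace (𝓡 n) x)]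
  [MeasurableSpace M] [BorelSpace M] [SecondCountableTopology M] [Nonempty M]

theorem integral_smoothAbsRpow_le {p : ℝ} (hp : 1 < p) {Ω : Set M} (hΩ : MeasurableSet Ω)
    {f : M → ℝ} {a b : ℝ}
    (hgrad : ∀ x ∈ Ω, ‖grad (n := n) f x‖ ≤ a) (hlap : WeakPLaplacianGE n p Ω f b)
    {φ : M → ℝ} (hφ : IsTestFunction n Ω φ) {ε : ℝ} (hε : 0 < ε) :
    b * ∫ x in Ω, smoothAbsRpow p ε (φ x) ∂(riemannianVolume n M) ≤
      ∫ x in Ω, a ^ (p - 1) * p * ((φ x ^ 2 + ε ^ 2) ^ ((p - 1) / 2) * ‖grad (n := n) φ x‖)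
        ∂(riemannianVolume n M) := by
  have hp0 : 0 ≤ p := by linarith
  have hψ : IsTestFunction n Ω (smoothAbsRpow p ε ∘ φ) :=
    ⟨(contDiff_smoothAbsRpow hε).contMDiff.comp hφ.smooth,
      hφ.compact.comp_left smoothAbsRpow_zero,
      (closure_mono (Function.support_comp_subset smoothAbsRpow_zero φ)).trans hφ.support⟩
  refine (hlap _ hψ fun x => smoothAbsRpow_nonneg hp0 _).trans ?_
  refine (neg_le_abs _).trans (abs_integral_le_integral_abs.trans ?_)
  -- Only the dominating function has to be integrable, so no measurability of `pField p f` enters.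
  refine integral_mono_of_nonneg (Eventually.of_forall fun x => abs_nonneg _) ?_ ?_
  · refine (Continuous.integrable_of_hasCompactSupport ?_ ?_).restrict
    · refine continuous_const.mul (Continuous.mul ?_ (continuous_norm_grad hφ.smooth))
      exact ((hφ.smooth.continuous.pow 2).add continuous_const).rpow_const
        fun x => Or.inr (by linarith)
    · exact (hasCompactSupport_norm_grad hφ).mul_left.mul_left
  · filter_upwards [ae_restrict_mem hΩ] with x hx
    have hg : grad (n := n) (smoothAbsRpow p ε ∘ φ) x =
        (p * φ x * (φ x ^ 2 + ε ^ 2) ^ (p / 2 - 1)) • grad φ x :=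
      grad_eq_smul fun v => dirDeriv_comp (hφ.smooth.mdifferentiable (by simp) x)
        (hasDerivAt_smoothAbsRpow hε _) v
    rw [hg, inner_smul_right, abs_mul]
    calc |p * φ x * (φ x ^ 2 + ε ^ 2) ^ (p / 2 - 1)| *
          |inner ℝ (pField (n := n) p f x) (grad φ x)|
        ≤ (p * (φ x ^ 2 + ε ^ 2) ^ ((p - 1) / 2)) * (a ^ (p - 1) * ‖grad (n := n) φ x‖) := by
          refine mul_le_mul (abs_deriv_smoothAbsRpow_le hp0 hε _)
            ((abs_real_inner_le_norm _ _).trans ?_) (abs_nonneg _)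
            (mul_nonneg hp0 (Real.rpow_nonneg (by positivity) _))
          exact mul_le_mul_of_nonneg_right (norm_pField_le hp (hgrad x hx)) (norm_nonneg _)
      _ = a ^ (p - 1) * p * ((φ x ^ 2 + ε ^ 2) ^ ((p - 1) / 2) * ‖grad (n := n) φ x‖) := by ring

/-- Limit `ε → 0` of the smoothed inequality by dominated convergence; along `ε ≤ 1` the value `ε =
1` supplies the majorants. -/
theorem integral_abs_rpow_le {p : ℝ} (hp : 1 < p) {Ω : Set M} (hΩ : MeasurableSet Ω)
    {f : M → ℝ} {a b : ℝ}
    (hgrad : ∀ x ∈ Ω, ‖grad (n := n) f x‖ ≤ a) (hlap : WeakPLaplacianGE n p Ω f b)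
    {φ : M → ℝ} (hφ : IsTestFunction n Ω φ) :
    b * ∫ x in Ω, |φ x| ^ p ∂(riemannianVolume n M) ≤
      a ^ (p - 1) * p * ∫ x in Ω, |φ x| ^ (p - 1) * ‖grad (n := n) φ x‖ ∂(riemannianVolume n M) := by
  have hp0 : 0 < p := by linarith
  set ε : ℕ → ℝ := fun k => 1 / ((k : ℝ) + 1) with hεdef
  have hε : ∀ k, 0 < ε k := fun k => Nat.one_div_pos_of_nat
  have hε1 : ∀ k, ε k ≤ 1 := fun k => by
    rw [hεdef]
    exact div_le_one_of_le₀ (by linarith [k.cast_nonneg (α := ℝ)]) (by positivity)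
  have hεlim : Tendsto ε atTop (𝓝 0) := tendsto_one_div_add_atTop_nhds_zero_nat
  have hlimrpow : ∀ (t q : ℝ), 0 < q →
      Tendsto (fun k => (t ^ 2 + ε k ^ 2) ^ (q / 2)) atTop (𝓝 (|t| ^ q)) := by
    intro t q hq
    have h1 : Tendsto (fun k => t ^ 2 + ε k ^ 2) atTop (𝓝 (t ^ 2)) := by
      simpa using (hεlim.pow 2).const_add (t ^ 2)
    rw [← sq_rpow_half]
    exact h1.rpow_const (Or.inr (by linarith))
  have hcs : Continuous φ := hφ.smooth.continuous
  have hL : Tendsto (fun k => ∫ x in Ω, smoothAbsRpow p (ε k) (φ x) ∂(riemannianVolume n M)) atTop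
      (𝓝 (∫ x in Ω, |φ x| ^ p ∂(riemannianVolume n M))) := by
    refine tendsto_integral_of_dominated_convergence
      -- The majorant equals `1` where `φ = 0`, so it is cut off to the support of `φ` to be
      -- integrable.
      ((tsupport φ).indicator fun x => (φ x ^ 2 + 1) ^ (p / 2)) (fun k => ?_) ?_ (fun k => ?_) ?_
    · exact ((contDiff_smoothAbsRpow (hε k)).continuous.comp hcs).aestronglyMeasurable
    · refine Integrable.restrict ?_
      rw [integrable_indicator_iff (isClosed_tsupport φ).measurableSet]
      refine ContinuousOn.integrableOn_compact hφ.compact.isCompact (Continuous.continuousOn ?_)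
      exact ((hcs.pow 2).add continuous_const).rpow_const fun x => Or.inr (by linarith)
    · refine Eventually.of_forall fun x => ?_
      by_cases hx : x ∈ tsupport φ
      · rw [indicator_of_mem hx, Real.norm_of_nonneg (smoothAbsRpow_nonneg hp0.le _)]
        refine (sub_le_self _ (Real.rpow_nonneg (sq_nonneg _) _)).trans ?_
        have := pow_le_one₀ (n := 2) (hε k).le (hε1 k)
        gcongr
      · rw [indicator_of_notMem hx, image_eq_zero_of_notMem_tsupport hx, smoothAbsRpow_zero,
          norm_zero]
    · refine Eventually.of_forall fun x => ?_
      have h0 := hlimrpow 0 p hp0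
      simp only [ne_eq, OfNat.ofNat_ne_zero, not_false_eq_true, zero_pow, zero_add, abs_zero,
        Real.zero_rpow hp0.ne'] at h0
      simpa [smoothAbsRpow] using (hlimrpow (φ x) p hp0).sub h0
  have hR : Tendsto (fun k => ∫ x in Ω, a ^ (p - 1) * p *
      ((φ x ^ 2 + ε k ^ 2) ^ ((p - 1) / 2) * ‖grad (n := n) φ x‖) ∂(riemannianVolume n M)) atTop
      (𝓝 (∫ x in Ω, a ^ (p - 1) * p * (|φ x| ^ (p - 1) * ‖grad (n := n) φ x‖)
        ∂(riemannianVolume n M))) := by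
    have hcont : ∀ c : ℝ, Continuous fun x =>
        (φ x ^ 2 + c) ^ ((p - 1) / 2) * ‖grad (n := n) φ x‖ := fun c =>
      (((hcs.pow 2).add continuous_const).rpow_const fun x => Or.inr (by linarith)).mul
        (continuous_norm_grad hφ.smooth)
    refine tendsto_integral_of_dominated_convergence (fun x => ‖a ^ (p - 1) * p‖ *
      ((φ x ^ 2 + 1) ^ ((p - 1) / 2) * ‖grad (n := n) φ x‖)) (fun k => ?_) ?_ (fun k => ?_) ?_
    · exact (continuous_const.mul (hcont _)).aestronglyMeasurable
    · exact ((continuous_const.mul (hcont 1)).integrable_of_hasCompactSupport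
        (hasCompactSupport_norm_grad hφ).mul_left.mul_left).restrict
    · refine Eventually.of_forall fun x => ?_
      rw [norm_mul]
      refine mul_le_mul_of_nonneg_left ?_ (norm_nonneg _)
      rw [Real.norm_of_nonneg (by positivity)]
      have := pow_le_one₀ (n := 2) (hε k).le (hε1 k)
      have hp1 : 0 ≤ (p - 1) / 2 := by linarith
      gcongr
    · exact Eventually.of_forall fun x =>
        ((hlimrpow (φ x) (p - 1) (by linarith)).mul_const _).const_mul _
  rw [integral_const_mul (a ^ (p - 1) * p) (fun x => |φ x| ^ (p - 1) * ‖grad (n := n) φ x‖)] at hR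
  exact le_of_tendsto_of_tendsto' (hL.const_mul b) hR fun k =>
    integral_smoothAbsRpow_le hp hΩ hgrad hlap hφ (hε k)

/-- Hölder with exponents `p / (p - 1)` and `p` bounds `b A` by `p a^(p-1) A^((p-1)/p) B^(1/p)`.
Cancelling, when `A > 0`, leaves `b A^(1/p) ≤ p a^(p-1) B^(1/p)`, whose `p`-th power is the claim.
-/
theorem mul_integral_abs_rpow_le {p : ℝ} (hp : 1 < p) {Ω : Set M} (hΩ : MeasurableSet Ω)
    {f : M → ℝ} {a b : ℝ} (ha : 0 < a) (hb : 0 < b)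
    (hgrad : ∀ x ∈ Ω, ‖grad (n := n) f x‖ ≤ a) (hlap : WeakPLaplacianGE n p Ω f b)
    {φ : M → ℝ} (hφ : IsTestFunction n Ω φ) :
    b ^ p / (p ^ p * a ^ (p * (p - 1))) * ∫ x in Ω, |φ x| ^ p ∂(riemannianVolume n M) ≤
      ∫ x in Ω, ‖grad (n := n) φ x‖ ^ p ∂(riemannianVolume n M) := by
  have hp0 : 0 < p := by linarith
  have hp1 : 0 < p - 1 := by linarith
  set A := ∫ x in Ω, |φ x| ^ p ∂(riemannianVolume n M) with hA
  set B := ∫ x in Ω, ‖grad (n := n) φ x‖ ^ p ∂(riemannianVolume n M) with hB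
  have hA0 : 0 ≤ A := integral_nonneg fun x => Real.rpow_nonneg (abs_nonneg _) _
  have hB0 : 0 ≤ B := integral_nonneg fun x => Real.rpow_nonneg (norm_nonneg _) _
  have hpq : (p / (p - 1)).HolderConjugate p := (Real.HolderConjugate.conjExponent hp).symm
  have hcs : Continuous φ := hφ.smooth.continuous
  have hc1 : Continuous fun x => |φ x| ^ (p - 1) := hcs.abs.rpow_const fun x => Or.inr hp1.le
  have hholder : ∫ x in Ω, |φ x| ^ (p - 1) * ‖grad (n := n) φ x‖ ∂(riemannianVolume n M) ≤
      A ^ ((p - 1) / p) * B ^ (1 / p) := by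
    have h := integral_mul_le_Lp_mul_Lq_of_nonneg (μ := (riemannianVolume n M).restrict Ω) hpq
      (f := fun x => |φ x| ^ (p - 1)) (g := fun x => ‖grad (n := n) φ x‖)
      (Eventually.of_forall fun x => by positivity) (Eventually.of_forall fun x => norm_nonneg _)
      (MemLp.restrict _ <| hc1.memLp_of_hasCompactSupport
        (hφ.compact.comp_left (g := fun t => |t| ^ (p - 1)) (by simp [hp1.ne'])))
      (MemLp.restrict _ <| (continuous_norm_grad hφ.smooth).memLp_of_hasCompactSupport
        (hasCompactSupport_norm_grad hφ))
    have h2 : ∀ x, (|φ x| ^ (p - 1)) ^ (p / (p - 1)) = |φ x| ^ p := fun x => by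
      rw [← Real.rpow_mul (abs_nonneg _), mul_div_cancel₀ _ hp1.ne']
    simp only [h2, one_div_div] at h
    exact h
  have hmain : b * A ≤ a ^ (p - 1) * p * (A ^ ((p - 1) / p) * B ^ (1 / p)) :=
    (integral_abs_rpow_le hp hΩ hgrad hlap hφ).trans
      (mul_le_mul_of_nonneg_left hholder (by positivity))
  rcases hA0.eq_or_lt with h0 | hApos
  · rw [← h0, mul_zero]
    exact hB0
  have hsplit : A = A ^ ((p - 1) / p) * A ^ (1 / p) := by
    rw [← Real.rpow_add hApos, ← add_div, sub_add_cancel, div_self hp0.ne', Real.rpow_one]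
  have hdiv : b * A ^ (1 / p) ≤ a ^ (p - 1) * p * B ^ (1 / p) := by
    have hX : 0 < A ^ ((p - 1) / p) := Real.rpow_pos_of_pos hApos _
    refine le_of_mul_le_mul_left ?_ hX
    calc A ^ ((p - 1) / p) * (b * A ^ (1 / p)) = b * (A ^ ((p - 1) / p) * A ^ (1 / p)) := by ring
      _ = b * A := by rw [← hsplit]
      _ ≤ _ := hmain
      _ = _ := by ring
  have hpow := Real.rpow_le_rpow (by positivity) hdiv hp0.le
  have hroot : ∀ {t : ℝ}, 0 ≤ t → (t ^ (1 / p)) ^ p = t := fun ht => by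
    rw [← Real.rpow_mul ht, one_div_mul_cancel hp0.ne', Real.rpow_one]
  rw [Real.mul_rpow hb.le (by positivity), Real.mul_rpow (by positivity) (by positivity),
    Real.mul_rpow (by positivity) hp0.le, hroot hA0, hroot hB0, ← Real.rpow_mul ha.le] at hpow
  rw [div_mul_eq_mul_div, div_le_iff₀ (by positivity), mul_comm p (p - 1)]
  linarith

end Eigenvalue

/-! ### Passage to `W_0^{1,p}` and to eigenvalues -/

section Sobolev

variable {n : ℕ} {M : Type*} [EMetricSpace M] [ChartedSpace (EuclideanSpace ℝ (Fin n)) M]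
  [RiemannianBundle (fun x : M => TangentSpace (𝓡 n) x)] [IsManifold (𝓡 n) ∞ M]
  [IsContMDiffRiemannianBundle (𝓡 n) ∞ (EuclideanSpace ℝ (Fin n))
      (fun x : M => TangentSpace (𝓡 n) x)]
  [MeasurableSpace M] [BorelSpace M] [SecondCountableTopology M] [Nonempty M]

theorem mul_lintegral_enorm_rpow_le_of_isTestFunction {p : ℝ} (hp : 1 < p) {Ω : Set M}
    (hΩ : MeasurableSet Ω) {f : M → ℝ} {a b : ℝ} (ha : 0 < a) (hb : 0 < b)
    (hgrad : ∀ x ∈ Ω, ‖grad (n := n) f x‖ ≤ a) (hlap : WeakPLaplacianGE n p Ω f b)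
    {φ : M → ℝ} (hφ : IsTestFunction n Ω φ) :
    ENNReal.ofReal (b ^ p / (p ^ p * a ^ (p * (p - 1)))) *
        ∫⁻ x in Ω, ‖φ x‖ₑ ^ p ∂(riemannianVolume n M) ≤
      ∫⁻ x in Ω, ‖grad (n := n) φ x‖ₑ ^ p ∂(riemannianVolume n M) := by
  have hp0 : 0 < p := by linarith
  have h1 : Integrable (fun x => |φ x| ^ p) ((riemannianVolume n M).restrict Ω) :=
    ((hφ.smooth.continuous.abs.rpow_const fun x => Or.inr hp0.le).integrable_of_hasCompactSupport
      (hφ.compact.comp_left (g := fun t => |t| ^ p) (by simp [hp0.ne']))).restrict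
  have h2 : Integrable (fun x => ‖grad (n := n) φ x‖ ^ p) ((riemannianVolume n M).restrict Ω) :=
    (((continuous_norm_grad hφ.smooth).rpow_const fun x =>
      Or.inr hp0.le).integrable_of_hasCompactSupport
      ((hasCompactSupport_norm_grad hφ).comp_left (g := fun t => t ^ p) (by simp [hp0.ne']))).restrict
  have e1 : ∫⁻ x in Ω, ‖φ x‖ₑ ^ p ∂(riemannianVolume n M) =
      ENNReal.ofReal (∫ x in Ω, |φ x| ^ p ∂(riemannianVolume n M)) := by
    rw [ofReal_integral_eq_lintegral_ofReal h1 (Eventually.of_forall fun x => by positivity)]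
    refine lintegral_congr fun x => ?_
    rw [← ofReal_norm, ENNReal.ofReal_rpow_of_nonneg (norm_nonneg _) hp0.le,
      Real.norm_eq_abs]
  have e2 : ∫⁻ x in Ω, ‖grad (n := n) φ x‖ₑ ^ p ∂(riemannianVolume n M) =
      ENNReal.ofReal (∫ x in Ω, ‖grad (n := n) φ x‖ ^ p ∂(riemannianVolume n M)) := by
    rw [ofReal_integral_eq_lintegral_ofReal h2 (Eventually.of_forall fun x => by positivity)]
    refine lintegral_congr fun x => ?_
    rw [← ofReal_norm, ENNReal.ofReal_rpow_of_nonneg (norm_nonneg _) hp0.le]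
  rw [e1, e2, ← ENNReal.ofReal_mul (by positivity)]
  exact ENNReal.ofReal_le_ofReal (mul_integral_abs_rpow_le hp hΩ ha hb hgrad hlap hφ)

theorem aemeasurable_enorm_of_aemeasurableField {Ω : Set M} (hΩ : MeasurableSet Ω)
    {X : ∀ x : M, TangentSpace (𝓡 n) x} (hX : AEMeasurableField Ω X) :
    AEMeasurable (fun x => ‖X x‖ₑ) ((riemannianVolume n M).restrict Ω) := by
  simp only [← ofReal_norm]
  exact (aemeasurable_norm_of_aemeasurableField hΩ hX).ennreal_ofReal

/-- After taking `p`-th roots, Minkowski's inequality compares `u` with `φ k` and `∇φ k` with `G`;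
both errors tend to `0`. Finiteness of `c` keeps the error on the left negligible after
multiplication. -/
theorem mul_lintegral_enorm_rpow_le_of_isW01p {p : ℝ} (hp : 1 < p) {Ω : Set M}
    (hΩ : MeasurableSet Ω) {c : ℝ≥0∞} (hc : c ≠ ⊤)
    (hineq : ∀ φ : M → ℝ, IsTestFunction n Ω φ →
      c * ∫⁻ x in Ω, ‖φ x‖ₑ ^ p ∂(riemannianVolume n M) ≤
        ∫⁻ x in Ω, ‖grad (n := n) φ x‖ₑ ^ p ∂(riemannianVolume n M))
    {u : M → ℝ} {G : ∀ x : M, TangentSpace (𝓡 n) x} (hu : IsW01p p Ω u G) :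
    c * ∫⁻ x in Ω, ‖u x‖ₑ ^ p ∂(riemannianVolume n M) ≤
      ∫⁻ x in Ω, ‖G x‖ₑ ^ p ∂(riemannianVolume n M) := by
  have hp0 : 0 < p := by linarith
  obtain ⟨φ, hφ, hlim1, hlim2⟩ := hu.exists_approx
  set μ := (riemannianVolume n M).restrict Ω with hμ
  have hum : AEMeasurable u μ := hu.memLp.aestronglyMeasurable.aemeasurable
  have hφm : ∀ k, AEMeasurable (φ k) μ := fun k => (hφ k).smooth.continuous.aemeasurable
  have hGm : AEMeasurable (fun x => ‖G x‖ₑ) μ :=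
    aemeasurable_enorm_of_aemeasurableField hΩ hu.aemeasurable_grad
  have hdm : ∀ k, AEMeasurable (fun x => ‖grad (n := n) (φ k) x - G x‖ₑ) μ := fun k =>
    aemeasurable_enorm_of_aemeasurableField hΩ
      ((aemeasurableField_grad hΩ (hφ k).smooth).sub hu.aemeasurable_grad)
  set N : (M → ℝ≥0∞) → ℝ≥0∞ := fun h => (∫⁻ x, h x ^ p ∂μ) ^ (1 / p) with hN
  have hroot : ∀ {I : ℕ → ℝ≥0∞}, Tendsto I atTop (𝓝 0) →
      Tendsto (fun k => I k ^ (1 / p)) atTop (𝓝 0) := by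
    intro I hI
    have h := (ENNReal.continuous_rpow_const (y := 1 / p)).tendsto 0 |>.comp hI
    rwa [ENNReal.zero_rpow_of_pos (by positivity)] at h
  have hmono : ∀ {g h : M → ℝ≥0∞}, (∀ x, g x ≤ h x) → N g ≤ N h := fun hgh =>
    ENNReal.rpow_le_rpow (lintegral_mono fun x => ENNReal.rpow_le_rpow (hgh x) hp0.le)
      (by positivity)
  have hadd : ∀ {g h : M → ℝ≥0∞}, AEMeasurable g μ → AEMeasurable h μ →
      N (fun x => g x + h x) ≤ N g + N h := fun hg hh =>
    ENNReal.lintegral_Lp_add_le hg hh hp.le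
  set d := c ^ (1 / p) with hd
  have hd_top : d ≠ ⊤ := ENNReal.rpow_ne_top_of_nonneg (by positivity) hc
  have hstep : ∀ k, d * N (fun x => ‖u x‖ₑ) ≤
      d * N (fun x => ‖φ k x - u x‖ₑ) + (N (fun x => ‖grad (n := n) (φ k) x - G x‖ₑ) +
        N (fun x => ‖G x‖ₑ)) := by
    intro k
    have h1 : N (fun x => ‖u x‖ₑ) ≤ N (fun x => ‖φ k x - u x‖ₑ) + N (fun x => ‖φ k x‖ₑ) := by
      refine le_trans (hmono fun x => ?_) (hadd ((hφm k).sub hum).enorm (hφm k).enorm)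
      have := enorm_sub_le (a := φ k x) (b := φ k x - u x)
      rw [sub_sub_cancel] at this
      rwa [add_comm]
    have h2 : d * N (fun x => ‖φ k x‖ₑ) ≤ N (fun x => ‖grad (n := n) (φ k) x‖ₑ) := by
      have := ENNReal.rpow_le_rpow (hineq (φ k) (hφ k)) (z := 1 / p) (by positivity)
      rwa [ENNReal.mul_rpow_of_nonneg _ _ (by positivity)] at this
    have h3 : N (fun x => ‖grad (n := n) (φ k) x‖ₑ) ≤
        N (fun x => ‖grad (n := n) (φ k) x - G x‖ₑ) + N (fun x => ‖G x‖ₑ) := by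
      refine le_trans (hmono fun x => ?_) (hadd (hdm k) hGm)
      have := enorm_add_le (grad (n := n) (φ k) x - G x) (G x)
      rwa [sub_add_cancel] at this
    calc d * N (fun x => ‖u x‖ₑ)
        ≤ d * (N (fun x => ‖φ k x - u x‖ₑ) + N (fun x => ‖φ k x‖ₑ)) := by gcongr
      _ = d * N (fun x => ‖φ k x - u x‖ₑ) + d * N (fun x => ‖φ k x‖ₑ) := mul_add _ _ _
      _ ≤ _ := by gcongr; exact h2.trans h3
  have hlim : Tendsto (fun k => d * N (fun x => ‖φ k x - u x‖ₑ) +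
      (N (fun x => ‖grad (n := n) (φ k) x - G x‖ₑ) + N (fun x => ‖G x‖ₑ))) atTop
      (𝓝 (d * 0 + (0 + N (fun x => ‖G x‖ₑ)))) :=
    (ENNReal.Tendsto.const_mul (hroot hlim1) (Or.inr hd_top)).add
      ((hroot hlim2).add tendsto_const_nhds)
  have hfinal : d * N (fun x => ‖u x‖ₑ) ≤ N (fun x => ‖G x‖ₑ) := by
    simpa using ge_of_tendsto' hlim hstep
  rw [hN, hd, ← ENNReal.mul_rpow_of_nonneg _ _ (by positivity)] at hfinal
  exact (ENNReal.rpow_le_rpow_iff (by positivity)).1 hfinal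

/-- Testing the equation with `u` itself gives `∫ ‖G‖^p = lam ∫ |u|^p`, and `∫ |u|^p > 0` can be
divided out. -/
theorem le_of_isDirichletEigenvalue {p : ℝ} (hp : 1 < p) {Ω : Set M} (hΩ : MeasurableSet Ω) {c : ℝ}
    (hineq : ∀ (u : M → ℝ) (G : ∀ x : M, TangentSpace (𝓡 n) x), IsW01p p Ω u G →
      ENNReal.ofReal c * ∫⁻ x in Ω, ‖u x‖ₑ ^ p ∂(riemannianVolume n M) ≤
        ∫⁻ x in Ω, ‖G x‖ₑ ^ p ∂(riemannianVolume n M))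
    {lam : ℝ} (hlam : IsDirichletEigenvalue n p Ω lam) : c ≤ lam := by
  have hp0 : 0 < p := by linarith
  obtain ⟨u, G, hu, hune, hweak⟩ := hlam
  have h := hweak u G hu
  have hI := hineq u G hu
  have hGm := aemeasurable_norm_of_aemeasurableField hΩ hu.aemeasurable_grad
  set μ := (riemannianVolume n M).restrict Ω with hμ
  -- Valid also where `G x = 0`, because the total exponent `p` is nonzero.
  have h1 : ∀ x, ‖G x‖ ^ (p - 2) * inner ℝ (G x) (G x) = ‖G x‖ ^ p := fun x => by
    rw [real_inner_self_eq_norm_sq, ← Real.rpow_natCast,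
      ← Real.rpow_add' (norm_nonneg _) (by push_cast; linarith)]
    push_cast
    ring_nf
  have h2 : ∀ x, |u x| ^ (p - 2) * u x * u x = |u x| ^ p := fun x => by
    rw [mul_assoc, ← sq, ← sq_abs, ← Real.rpow_natCast,
      ← Real.rpow_add' (abs_nonneg _) (by push_cast; linarith)]
    push_cast
    ring_nf
  simp only [h1, h2] at h
  have hui : Integrable (fun x => |u x| ^ p) μ := by
    have := hu.memLp.integrable_norm_rpow (by simpa using hp0) ENNReal.ofReal_ne_top
    rwa [ENNReal.toReal_ofReal hp0.le] at this
  have e1 : ∫⁻ x, ‖u x‖ₑ ^ p ∂μ = ENNReal.ofReal (∫ x, |u x| ^ p ∂μ) := by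
    rw [ofReal_integral_eq_lintegral_ofReal hui (Eventually.of_forall fun x => by positivity)]
    refine lintegral_congr fun x => ?_
    rw [← ofReal_norm, ENNReal.ofReal_rpow_of_nonneg (norm_nonneg _) hp0.le,
      Real.norm_eq_abs]
  have e2 : ∀ x, ‖G x‖ₑ ^ p = ENNReal.ofReal (‖G x‖ ^ p) := fun x => by
    rw [← ofReal_norm, ENNReal.ofReal_rpow_of_nonneg (norm_nonneg _) hp0.le]
  have hG : ∫ x, ‖G x‖ ^ p ∂μ = (∫⁻ x, ‖G x‖ₑ ^ p ∂μ).toReal := by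
    rw [integral_eq_lintegral_of_nonneg_ae (Eventually.of_forall fun x => by positivity)
      (hGm.pow_const p).aestronglyMeasurable]
    simp only [e2]
  have hupos : 0 < ∫ x, |u x| ^ p ∂μ := by
    refine (integral_nonneg fun x => by positivity).lt_of_ne' fun h0 => hune ?_
    have := (integral_eq_zero_iff_of_nonneg (fun x => by positivity) hui).1 h0
    filter_upwards [this] with x hx
    exact abs_eq_zero.1 ((Real.rpow_eq_zero (abs_nonneg _) hp0.ne').1 hx)
  have hle : c * ∫ x, |u x| ^ p ∂μ ≤ lam * ∫ x, |u x| ^ p ∂μ := by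
    rw [← h, hG]
    rw [e1] at hI
    rw [← ENNReal.ofReal_mul' hupos.le] at hI
    exact (ENNReal.ofReal_le_iff_le_toReal hu.grad_lt_top.ne).1 hI
  exact le_of_mul_le_mul_right hle hupos

end Sobolev

end RiemannianPLaplacian

/-! ### The main theorem -/

theorem theorem1 {n : ℕ} {M : Type*} [EMetricSpace M] [SecondCountableTopology M] [Nonempty M]
    [MeasurableSpace M] [BorelSpace M]
    [ChartedSpace (EuclideanSpace ℝ (Fin n)) M] [IsManifold (𝓡 n) ∞ M]
    [RiemannianBundle (fun x : M => TangentSpace (𝓡 n) x)]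
    [IsContMDiffRiemannianBundle (𝓡 n) ∞ (EuclideanSpace ℝ (Fin n))
      (fun x : M => TangentSpace (𝓡 n) x)]
    [IsRiemannianManifold (𝓡 n) M]
    (p : ℝ) (hp : 1 < p)
    (Ω : Set M) (hΩ_open : IsOpen Ω) (hΩ_conn : IsConnected Ω) (hΩ_bdd : Metric.ediam Ω < ⊤)
    (f : M → ℝ) (hf : ContMDiffOn (𝓡 n) 𝓘(ℝ, ℝ) ∞ f Ω)
    (a b : ℝ) (ha : 0 < a) (hb : 0 < b)
    (hgrad : ∀ x ∈ Ω, ‖grad (n := n) f x‖ ≤ a)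
    (hlap : (∀ x ∈ Ω, b ≤ pLaplacian n p f x) ∨ WeakPLaplacianGE n p Ω f b) :
    ENNReal.ofReal (b ^ p / (p ^ p * a ^ (p * (p - 1)))) ≤ firstEigenvalue n p Ω ∧
      ∀ lam : ℝ, IsDirichletEigenvalue n p Ω lam → b ^ p / (p ^ p * a ^ (p * (p - 1))) ≤ lam := by
  have hp0 : 0 < p := by linarith
  have hΩ : MeasurableSet Ω := hΩ_open.measurableSet
  have hweak : WeakPLaplacianGE n p Ω f b :=
    hlap.elim (weakPLaplacianGE_of_le_pLaplacian hΩ_open hb) id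
  have hineq : ∀ (u : M → ℝ) (G : ∀ x : M, TangentSpace (𝓡 n) x), IsW01p p Ω u G →
      ENNReal.ofReal (b ^ p / (p ^ p * a ^ (p * (p - 1)))) *
          ∫⁻ x in Ω, ‖u x‖ₑ ^ p ∂(riemannianVolume n M) ≤
        ∫⁻ x in Ω, ‖G x‖ₑ ^ p ∂(riemannianVolume n M) := fun u G hu =>
    mul_lintegral_enorm_rpow_le_of_isW01p hp hΩ ENNReal.ofReal_ne_top (fun φ hφ =>
      mul_lintegral_enorm_rpow_le_of_isTestFunction hp hΩ ha hb hgrad hweak hφ) hu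
  refine ⟨?_, fun lam hlam => le_of_isDirichletEigenvalue hp hΩ hineq hlam⟩
  refine le_iInf fun u => le_iInf fun G => le_iInf fun hu => le_iInf fun hune => ?_
  -- Clearing the denominator in `ℝ≥0∞` has to exclude `0/0` and `⊤/⊤`: the denominator is nonzero
  -- as `u` is not almost everywhere zero, and the numerator is finite.
  rw [ENNReal.le_div_iff_mul_le]
  · exact hineq u G hu
  · refine Or.inl fun h0 => hune ?_
    rw [lintegral_eq_zero_iff'
      (hu.memLp.aestronglyMeasurable.aemeasurable.enorm.pow_const p)] at h0
    filter_upwards [h0] with x hx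
    simpa [hp0, hp0.not_gt] using hx
  · refine Or.inr (hu.grad_lt_top.ne)
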